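/- Let $k$ be a ring, and let $X$ be a connected and locally simply connected topological space. Here a space is called simply connected if it is connected and every covering of it is trivial (i.e. isomorphic over it to its product with a discrete space), and $X$ is called locally simply connected if every neighbourhood of every point of $X$ contains a simply connected open neighbourhood of that point. Let $\operatorname{Shv}_k(X)$ be the category of sheaves of $k$-modules on $X$, let $k_X$ denote the constant sheaf, and let $\operatorname{Qcoh}_k(X)\subseteq \operatorname{Shv}_k(X)$ be the full subcategory of quasi-coherent sheaves, i.e. of those $F$ such that every point of $X$ has an open neighbourhood $U$ with an exact sequence $k_U^{\oplus I}\to k_U^{\oplus J}\to F|_U\to 0$ for some sets $I,J$. (The category $\operatorname{Qcoh}_k(X)$ is abelian, and its inclusion into $\operatorname{Shv}_k(X)$ is exact and has a right adjoint $\operatorname{Qc}\colon \operatorname{Shv}_k(X)\to\operatorname{Qcoh}_k(X)$.) Let $D^+(X)$ and $D^+(\operatorname{Qcoh}_k(X))$ be the bounded below derived categories of $\operatorname{Shv}_k(X)$ and $\operatorname{Qcoh}_k(X)$, and let $D^+_{\mathrm{qc}}(X)\subseteq D^+(X)$ be the full subcategory of the complexes all of whose cohomology sheaves are quasi-coherent.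 The inclusion induces a functor $i\colon D^+(\operatorname{Qcoh}_k(X))\to D^+(X)$, which takes its values in $D^+_{\mathrm{qc}}(X)$. Let $\mathbb R\operatorname{Qc}\colon D^+(X)\to D^+(\operatorname{Qcoh}_k(X))$ be the right derived functor of $\operatorname{Qc}$, and put $R^n\operatorname{Qc}(F)=H^n(\mathbb R\operatorname{Qc}(F))$. The functor $\mathbb R\operatorname{Qc}$ is right adjoint to $i$, through natural transformations $\epsilon\colon \mathrm{id}\to \mathbb R\operatorname{Qc}\circ i$ and $\mu\colon i\circ\mathbb R\operatorname{Qc}\to\mathrm{id}$ induced by the unit and the counit of the adjunction between the inclusion and $\operatorname{Qc}$. Then the following conditions are equivalent. 1. $i\colon D^+(\operatorname{Qcoh}_k(X))\to D^+_{\mathrm{qc}}(X)$ is an equivalence. 2. $i\colon D^+(\operatorname{Qcoh}_k(X))\to D^+_{\mathrm{qc}}(X)$ is fully faithful; equivalently, $\epsilon\colon \mathrm{id}\to\mathbb R\operatorname{Qc}\circ i$ is an isomorphism. 3. $R^n\operatorname{Qc}(\mathcal L)=0$ for every $n>0$ and every quasi-coherent sheaf $\mathcal L$. 4. The restriction $\mathbb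 R\operatorname{Qc}\colon D^+_{\mathrm{qc}}(X)\to D^+(\operatorname{Qcoh}_k(X))$ is fully faithful; equivalently, $\mu\colon i(\mathbb R\operatorname{Qc}(K))\to K$ is an isomorphism for every $K\in D^+_{\mathrm{qc}}(X)$. 5. The restriction $\mathbb R\operatorname{Qc}\colon D^+_{\mathrm{qc}}(X)\to D^+(\operatorname{Qcoh}_k(X))$ is an equivalence. -/

import Mathlib

open CategoryTheory Limits TopologicalSpace Opposite
universe u w₁ w₂

namespace KSheaf

/-- The category of sheaves of `k`-modules on `X`. -/
abbrev Shv (k : Type u) [Ring k] (X : Type u) [TopologicalSpace X] :=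
  Sheaf (Opens.grothendieckTopology X) (ModuleCat.{u} k)

instance Shv.hasColimits (k : Type u) [Ring k] (X : Type u) [TopologicalSpace X] :
    HasColimits (Shv k X) := IsGrothendieckAbelian.hasColimits _

/-- The constant sheaf `M_X` attached to a `k`-module `M`. -/
noncomputable abbrev constShv (k : Type u) [Ring k] (X : Type u) [TopologicalSpace X] :
    ModuleCat.{u} k ⥤ Shv k X :=
  constantSheaf (Opens.grothendieckTopology X) (ModuleCat.{u} k)

section
variable {k : Type u} [Ring k] {X : Type u} [TopologicalSpace X]

lemma constant_of_locally {Y : Type*} {S : Set X} (hS : IsPreconnected S)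
    {f : X → Y} (hf : ∀ x ∈ S, ∃ V : Set X, IsOpen V ∧ x ∈ V ∧ ∀ y ∈ S, y ∈ V → f y = f x)
    {x y : X} (hx : x ∈ S) (hy : y ∈ S) : f x = f y := by
  let _ : TopologicalSpace Y := ⊥
  have : DiscreteTopology Y := ⟨rfl⟩
  refine hS.constant (fun z hz => ?_) hx hy
  obtain ⟨V, hVo, hzV, h⟩ := hf z hz
  refine ContinuousWithinAt.congr_of_eventuallyEq (f := fun _ => f z)
    continuousWithinAt_const ?_ rfl
  filter_upwards [self_mem_nhdsWithin, mem_nhdsWithin_of_mem_nhds (hVo.mem_nhds hzV)] with w h1 h2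
  exact h w h1 h2

/-- The canonical map from `M` to the sections over `W` of the constant sheaf. -/
noncomputable def constUnit (M : ModuleCat.{u} k) (W : Opens X) :
    M ⟶ ((constShv k X).obj M).obj.obj (op W) :=
  (toSheafify (Opens.grothendieckTopology X) ((Functor.const _).obj M)).app (op W)

lemma constUnit_naturality (M : ModuleCat.{u} k) {V W : Opens X} (i : V ⟶ W) :
    constUnit M W ≫ ((constShv k X).obj M).obj.map i.op = constUnit M V := by
  have := (toSheafify (Opens.grothendieckTopology X) ((Functor.const _).obj M)).naturality i.op
  exact this.symm.trans (Category.id_comp _)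

lemma constUnit_res (M : ModuleCat.{u} k) {V W : Opens X} (i : V ⟶ W) (m : M) :
    ((constShv k X).obj M).obj.map i.op (constUnit M W m) = constUnit M V m :=
  ConcreteCategory.congr_hom (constUnit_naturality M i) m

lemma constUnit_injective (M : ModuleCat.{u} k) (W : Opens X) (hW : (W : Set X).Nonempty) :
    Function.Injective (constUnit M W) := by
  intro a b hab
  have := Presheaf.equalizerSieve_mem (Opens.grothendieckTopology X)
    (toSheafify (Opens.grothendieckTopology X) ((Functor.const (Opens X)ᵒᵖ).obj M))
    (X := op W) a b hab
  obtain ⟨x, hx⟩ := hW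
  obtain ⟨V, f, hf, -⟩ := this x hx
  simpa using hf

lemma constUnit_bijective (M : ModuleCat.{u} k) (W : Opens X) (hW : IsConnected (W : Set X)) :
    Function.Bijective (constUnit M W) := by
  refine ⟨constUnit_injective M W hW.nonempty, fun s => ?_⟩
  have hs := Presheaf.imageSieve_mem (Opens.grothendieckTopology X)
    (toSheafify (Opens.grothendieckTopology X) ((Functor.const (Opens X)ᵒᵖ).obj M)) (U := op W) s
  have hs' : ∀ x, ∃ (m : M) (V : Opens X), x ∈ W → ∃ (i : V ⟶ W), x ∈ V ∧
      constUnit M V m = ((constShv k X).obj M).obj.map i.op s := by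
    intro x
    by_cases hx : x ∈ W
    · obtain ⟨V, f, ⟨m, hm⟩, hV⟩ := hs x hx
      exact ⟨m, V, fun _ => ⟨f, hV, hm⟩⟩
    · exact ⟨0, ⊥, fun h => absurd h hx⟩
  choose m V hV using hs'
  have hloc : ∀ x (hx : x ∈ W), ∀ y (hy : y ∈ W), y ∈ V x → m y = m x := by
    intro x hx y hy hyV
    obtain ⟨i, -, hi⟩ := hV x hx
    obtain ⟨j, hyj, hj⟩ := hV y hy
    apply constUnit_injective M (V x ⊓ V y) ⟨y, hyV, hyj⟩
    rw [← constUnit_res M (homOfLE (inf_le_right : V x ⊓ V y ≤ V y)), hj,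
      ← constUnit_res M (homOfLE (inf_le_left : V x ⊓ V y ≤ V x)), hi,
      ← ConcreteCategory.comp_apply, ← ConcreteCategory.comp_apply,
      ← Functor.map_comp, ← Functor.map_comp]
    rfl
  obtain ⟨x₀, hx₀⟩ := hW.nonempty
  have hconst : ∀ x ∈ W, m x = m x₀ := by
    intro x hx
    refine constant_of_locally hW.isPreconnected ?_ hx hx₀
    intro x hx
    obtain ⟨i, hxi, -⟩ := hV x hx
    exact ⟨V x, (V x).isOpen, hxi, fun y hy hyV => hloc x hx y hy hyV⟩
  refine ⟨m x₀, ?_⟩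
  refine TopCat.Sheaf.eq_of_locally_eq' (X := TopCat.of X) ((constShv k X).obj M)
    (fun x : W => V x) W (fun x => (hV x x.2).choose) ?_ _ _ ?_
  · intro x hx
    exact Opens.mem_iSup.2 ⟨⟨x, hx⟩, (hV x hx).choose_spec.1⟩
  · intro x
    refine (constUnit_res M _ _).trans ?_
    rw [← hconst x x.2]
    exact (hV x x.2).choose_spec.2
end

section
variable (k : Type u) [Ring k] {X : TopCat.{u}}

/-- Restriction `F ↦ F|_U` of sheaves to an open subspace. -/
noncomputable abbrev restr (U : Opens X) : Shv k X ⥤ Shv k U := U.sheafRestrict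

noncomputable def restrAdj (U : Opens X) :
    restr k U ⊣ (TopCat.Sheaf.pushforward (ModuleCat.{u} k) U.inclusion' :) :=
  (TopCat.Sheaf.pullbackPushforwardAdjunction (ModuleCat.{u} k) U.inclusion').ofNatIsoLeft
    (U.isOpenEmbedding.sheafPullbackIso (ModuleCat.{u} k))

instance (U : Opens X) : (restr k U).IsLeftAdjoint := (restrAdj k U).isLeftAdjoint

noncomputable def constRestrIso (U : Opens X) : constShv k X ⋙ restr k U ≅ constShv k U :=
  (((constantSheafAdj (Opens.grothendieckTopology X) (ModuleCat.{u} k)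
    (T := (⊤ : Opens X)) isTerminalTop).comp (restrAdj k U)).leftAdjointUniq
    ((constantSheafAdj (Opens.grothendieckTopology U) (ModuleCat.{u} k)
    (T := (⊤ : Opens U)) isTerminalTop).ofNatIsoRight
      (Iso.refl _)))

instance constShv_isLeftAdjoint (X : Type u) [TopologicalSpace X] : (constShv k X).IsLeftAdjoint :=
  (constantSheafAdj (Opens.grothendieckTopology X) (ModuleCat.{u} k)
    (T := (⊤ : Opens X)) isTerminalTop).isLeftAdjoint

noncomputable def constShvFF (X : Type u) [TopologicalSpace X] [ConnectedSpace X] :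
    (constShv k X).FullyFaithful := by
  let adj := (constantSheafAdj (Opens.grothendieckTopology X) (ModuleCat.{u} k)
    (T := (⊤ : Opens X)) isTerminalTop)
  have : IsIso adj.unit := by
    rw [NatTrans.isIso_iff_isIso_app]
    intro M
    have : adj.unit.app M = constUnit M ⊤ := by
      simp [adj, constantSheafAdj, constUnit]
      rfl
    rw [this]
    exact (ConcreteCategory.isIso_iff_bijective _).2 (constUnit_bijective M ⊤ (by simpa using isConnected_univ))
  exact adj.fullyFaithfulLOfIsIsoUnit
end

section
variable (k : Type u) [Ring k]

/-- The direct sum `k_X^{⊕ I}` of copies of the constant sheaf `k_X`. -/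
noncomputable abbrev freeShv (X : Type u) [TopologicalSpace X] (I : Type u) : Shv k X :=
  ∐ fun _ : I => (constShv k X).obj (ModuleCat.of k k)

variable {k}

/-- There is an exact sequence `k_X^{⊕ I} ⟶ k_X^{⊕ J} ⟶ G ⟶ 0`. -/
def HasFreePresentation {X : Type u} [TopologicalSpace X] (G : Shv k X) : Prop :=
  ∃ (I J : Type u) (f : freeShv k X I ⟶ freeShv k X J) (g : freeShv k X J ⟶ G) (w : f ≫ g = 0),
    (ShortComplex.mk f g w).Exact ∧ Epi g

/-- `F` is quasi-coherent: every point has an open neighbourhood `U` on which there is an exact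
sequence `k_U^{⊕ I} ⟶ k_U^{⊕ J} ⟶ F|_U ⟶ 0`. -/
def IsQuasicoherent {X : TopCat.{u}} (F : Shv k X) : Prop :=
  ∀ x : X, ∃ U : Opens X, x ∈ U ∧ HasFreePresentation ((restr k U).obj F)

instance {X : TopCat.{u}} (U : Opens X) : (restr k U).Additive where
instance (X : Type u) [TopologicalSpace X] : (constShv k X).Additive := by
  have : ((Functor.const (Opens X)ᵒᵖ : ModuleCat.{u} k ⥤ _)).Additive := ⟨by intros; rfl⟩
  unfold constShv constantSheaf
  infer_instance

lemma exact_epi_map {C D : Type*} [Category* C] [Category* D] [Abelian C] [Abelian D]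
    (L : C ⥤ D) [L.Additive] [L.IsLeftAdjoint] (S : ShortComplex C) (h : S.Exact ∧ Epi S.g) :
    (S.map L).Exact ∧ Epi (L.map S.g) := by
  have h1 := L.preservesFiniteColimits_tfae
  have h2 := (h1.out 3 1 rfl rfl).mp (inferInstance : PreservesFiniteColimits _)
  exact h2 S h

lemma hasFreePresentation_of_iso {X : Type u} [TopologicalSpace X] {G A B : Shv k X} (I J : Type u)
    (eA : freeShv k X I ≅ A) (eB : freeShv k X J ≅ B) (f : A ⟶ B) (g : B ⟶ G) (w : f ≫ g = 0)
    (h : (ShortComplex.mk f g w).Exact ∧ Epi g) : HasFreePresentation G := by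
  refine ⟨I, J, eA.hom ≫ f ≫ eB.inv, eB.hom ≫ g, by simp [w], ?_, ?_⟩
  · refine (ShortComplex.exact_iff_of_iso ?_).1 h.1
    exact ShortComplex.isoMk eA.symm eB.symm (Iso.refl _) (by simp) (by simp)
  · have := h.2
    infer_instance

noncomputable def freeShvRestrIso {X : TopCat.{u}} (U : Opens X) (I : Type u) :
    freeShv k U I ≅ (restr k U).obj (freeShv k X I) :=
  (Sigma.mapIso fun _ => (constRestrIso k U).symm.app _) ≪≫
    (PreservesCoproduct.iso (restr k U) _).symm

lemma HasFreePresentation.restr {X : TopCat.{u}} {G : Shv k X} (h : HasFreePresentation G)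
    (U : Opens X) : HasFreePresentation ((restr k U).obj G) := by
  obtain ⟨I, J, f, g, w, h⟩ := h
  exact hasFreePresentation_of_iso I J (freeShvRestrIso U I) (freeShvRestrIso U J) _ _ _
    (exact_epi_map (KSheaf.restr k U) _ h)

noncomputable def freeShvConstIso (X : Type u) [TopologicalSpace X] (I : Type u) :
    freeShv k X I ≅ (constShv k X).obj (∐ fun _ : I => ModuleCat.of k k) :=
  (PreservesCoproduct.iso (constShv k X) _).symm

lemma HasFreePresentation.exists_const {X : Type u} [TopologicalSpace X] [ConnectedSpace X]
    {G : Shv k X} (h : HasFreePresentation G) :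
    ∃ M : ModuleCat.{u} k, Nonempty ((constShv k X).obj M ≅ G) := by
  obtain ⟨I, J, f, g, w, h⟩ := h
  let φ := (constShvFF k X).preimage ((freeShvConstIso X I).inv ≫ f ≫ (freeShvConstIso X J).hom)
  have hφ : (constShv k X).map φ = (freeShvConstIso X I).inv ≫ f ≫ (freeShvConstIso X J).hom :=
    (constShvFF k X).map_preimage _
  refine ⟨cokernel φ, ⟨PreservesCokernel.iso (constShv k X) φ ≪≫ ?_⟩⟩
  have e : cokernel f ≅ cokernel ((constShv k X).map φ) := cokernel.mapIso f
    ((constShv k X).map φ) (freeShvConstIso X I) (freeShvConstIso X J) (by simp [hφ])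
  have := h.2
  exact e.symm ≪≫ IsColimit.coconePointUniqueUpToIso (cokernelIsCokernel f) h.1.gIsCokernel

lemma hasFreePresentation_const (X : Type u) [TopologicalSpace X] (M : ModuleCat.{u} k) :
    HasFreePresentation ((constShv k X).obj M) := by
  have key (N : ModuleCat.{u} k) : Epi (Sigma.desc (fun n : N => (ModuleCat.ofHom (LinearMap.toSpanSingleton k N n) : ModuleCat.of k k ⟶ N))) := by
    rw [ModuleCat.epi_iff_surjective]
    intro n
    refine ⟨Sigma.ι (fun _ : N => ModuleCat.of k k) n (1 : k), ?_⟩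
    rw [← ConcreteCategory.comp_apply]
    simp
  let p := Sigma.desc (fun n : M => (ModuleCat.ofHom (LinearMap.toSpanSingleton k M n) : ModuleCat.of k k ⟶ M))
  have : Epi p := key M
  let q := Sigma.desc (fun n : (kernel p : ModuleCat.{u} k) => (ModuleCat.ofHom (LinearMap.toSpanSingleton k _ n) : ModuleCat.of k k ⟶ kernel p))
  have : Epi q := key _
  have hw : (q ≫ kernel.ι p) ≫ p = 0 := by simp
  have hex : (ShortComplex.mk (q ≫ kernel.ι p) p hw).Exact := by
    have h1 : (ShortComplex.mk (kernel.ι p) p (by simp)).Exact :=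
      ShortComplex.exact_of_f_is_kernel _ (kernelIsKernel p)
    let φ : ShortComplex.mk (q ≫ kernel.ι p) p hw ⟶ ShortComplex.mk (kernel.ι p) p (by simp) :=
      { τ₁ := q, τ₂ := 𝟙 _, τ₃ := 𝟙 _ }
    have : Epi φ.τ₁ := ‹Epi q›
    have : IsIso φ.τ₂ := inferInstanceAs (IsIso (𝟙 _))
    have : Mono φ.τ₃ := inferInstanceAs (Mono (𝟙 _))
    exact (ShortComplex.exact_iff_of_epi_of_isIso_of_mono φ).2 h1
  exact hasFreePresentation_of_iso _ _ (freeShvConstIso X _) (freeShvConstIso X _) _ _ _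
    (exact_epi_map (constShv k X) _ ⟨hex, ‹Epi p›⟩)
end

section

/-- `p : E → X` is a trivial covering: over `X`, the space `E` is homeomorphic to `X × S` with `S`
discrete. -/
def IsTrivialCovering {E X : Type u} [TopologicalSpace E] [TopologicalSpace X] (p : E → X) : Prop :=
  ∃ (S : Type u) (_ : TopologicalSpace S) (_ : DiscreteTopology S) (h : E ≃ₜ X × S),
    ∀ e, (h e).1 = p e

/-- A simply connected space: a connected space all of whose coverings are trivial. (No paths are
involved, in contrast to `SimplyConnectedSpace`.) -/
class SimplyConnected (X : Type u) [TopologicalSpace X] : Prop extends ConnectedSpace X where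
  trivial_of_isCoveringMap (E : Type u) [TopologicalSpace E] (p : E → X) :
    IsCoveringMap p → IsTrivialCovering p

/-- A locally simply connected space: every neighbourhood of a point contains a simply connected
open neighbourhood of it. -/
class LocallySimplyConnected (X : Type u) [TopologicalSpace X] : Prop where
  exists_le (x : X) (U : Opens X) : x ∈ U → ∃ V : Opens X, x ∈ V ∧ V ≤ U ∧ SimplyConnected V

variable {k : Type u} [Ring k]

lemma SimplyConnected.isConnected {X : Type u} [TopologicalSpace X] (V : Opens X)
    [SimplyConnected V] : IsConnected (V : Set X) :=
  isConnected_iff_connectedSpace.2 (inferInstanceAs (ConnectedSpace V))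

lemma constShv_map_bijective {X : Type u} [TopologicalSpace X] (M : ModuleCat.{u} k)
    {V W : Opens X} (i : V ⟶ W) (hV : IsConnected (V : Set X)) (hW : IsConnected (W : Set X)) :
    Function.Bijective (((constShv k X).obj M).obj.map i.op) := by
  have h := constUnit_naturality M i
  have h1 := constUnit_bijective M W hW
  have h2 := constUnit_bijective M V hV
  rw [← h] at h2
  have : Function.Bijective (((constShv k X).obj M).obj.map i.op ∘ constUnit M W) := by
    simpa using h2
  exact (Function.Bijective.of_comp_iff _ h1).1 this

lemma bijective_map_of_iso {C : Type u} [Category.{u} C] {F G : C ⥤ ModuleCat.{u} k} (e : F ≅ G)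
    {A B : C} (f : A ⟶ B) (h : Function.Bijective (F.map f)) : Function.Bijective (G.map f) := by
  have h' := (ConcreteCategory.isIso_iff_bijective (F.map f)).2 h
  exact (ConcreteCategory.isIso_iff_bijective _).1 ((NatIso.isIso_map_iff e f).1 h')

lemma bijective_map_transport {X : Type u} [TopologicalSpace X] (F : Shv k X) {V W V' W' : Opens X}
    (h : V ≤ W) (hV : V' = V) (hW : W' = W) (h' : V' ≤ W')
    (H : Function.Bijective (F.obj.map (homOfLE h').op)) :
    Function.Bijective (F.obj.map (homOfLE h).op) := by
  subst hV hW; exact H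

/-- The open subset `V ∩ U` of `U`. -/
def opensIn {X : TopCat.{u}} (U V : Opens X) : Opens U := (Opens.map U.inclusion').obj V

lemma functor_opensIn {X : TopCat.{u}} {U V : Opens X} (h : V ≤ U) :
    U.isOpenEmbedding.functor.obj (opensIn U V) = V := by
  ext x
  constructor
  · rintro ⟨y, hy, rfl⟩; exact hy
  · intro hx; exact ⟨⟨x, h hx⟩, hx, rfl⟩

lemma isConnected_opensIn {X : TopCat.{u}} {U V : Opens X} (h : V ≤ U)
    (hV : IsConnected (V : Set X)) : IsConnected (opensIn U V : Set U) := by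
  rw [← functor_opensIn h] at hV
  exact ⟨hV.nonempty.of_image,
    U.isOpenEmbedding.isInducing.isPreconnected_image.1 hV.isPreconnected⟩

lemma IsQuasicoherent.exists_bijective {X : TopCat.{u}} [LocallySimplyConnected X] {F : Shv k X}
    (hF : IsQuasicoherent F) (x : X) : ∃ W : Opens X, x ∈ W ∧ IsConnected (W : Set X) ∧
      ∀ (V : Opens X) (h : V ≤ W), IsConnected (V : Set X) →
        Function.Bijective (F.obj.map (homOfLE h).op) := by
  obtain ⟨U, hxU, hU⟩ := hF x
  obtain ⟨W, hxW, hWU, hW⟩ := LocallySimplyConnected.exists_le x U hxU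
  have hWc := SimplyConnected.isConnected W
  refine ⟨W, hxW, hWc, fun V hVW hV => ?_⟩
  have : ConnectedSpace (opensIn U W) :=
    isConnected_iff_connectedSpace.1 (isConnected_opensIn hWU hWc)
  obtain ⟨M, ⟨e⟩⟩ := (HasFreePresentation.restr (X := TopCat.of U) hU (opensIn U W)).exists_const
  have hle : opensIn U V ≤ opensIn U W := fun y hy => hVW hy
  have hVU : IsConnected (opensIn U V : Set U) := isConnected_opensIn (hVW.trans hWU) hV
  have hV' := isConnected_opensIn (X := TopCat.of U) hle hVU
  have := bijective_map_of_iso ((sheafToPresheaf _ _).mapIso e)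
    (homOfLE (le_top : opensIn (X := TopCat.of U) (opensIn U W) (opensIn U V) ≤ ⊤)).op
    (constShv_map_bijective M _ hV' (by simpa using isConnected_univ))
  have e1 : U.isOpenEmbedding.functor.obj ((Opens.isOpenEmbedding (X := TopCat.of U)
      (opensIn U W)).functor.obj (opensIn (X := TopCat.of U) (opensIn U W) (opensIn U V))) = V :=
    (congrArg U.isOpenEmbedding.functor.obj (functor_opensIn (X := TopCat.of U) hle)).trans
      (functor_opensIn (hVW.trans hWU))
  have e2 : U.isOpenEmbedding.functor.obj ((Opens.isOpenEmbedding (X := TopCat.of U)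
      (opensIn U W)).functor.obj ⊤) = W :=
    (congrArg U.isOpenEmbedding.functor.obj
      (Opens.isOpenEmbedding_obj_top (X := TopCat.of U) (opensIn U W))).trans (functor_opensIn hWU)
  exact bijective_map_transport F hVW e1 e2 (e1.le.trans (hVW.trans e2.ge)) this

end

section
open Topology
variable {k : Type u} [Ring k] {X : TopCat.{u}}

lemma exists_germ_bijective [LocallySimplyConnected X] {F : Shv k X} (x : X)
    {W : Opens X} (hx : x ∈ W)
    (hW : ∀ (V : Opens X) (h : V ≤ W), IsConnected (V : Set X) →
        Function.Bijective (F.obj.map (homOfLE h).op)) :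
    Function.Bijective (TopCat.Presheaf.germ (C := ModuleCat.{u} k) F.obj W x hx) := by
  constructor
  · intro s t hst
    obtain ⟨V, hxV, i, j, h⟩ := TopCat.Presheaf.germ_eq F.obj x hx hx s t hst
    obtain ⟨V', hxV', hV', hc⟩ := LocallySimplyConnected.exists_le x V hxV
    refine (hW V' (hV'.trans i.le) (SimplyConnected.isConnected V')).1 ?_
    have := congrArg (F.obj.map (homOfLE hV').op) h
    rw [← ConcreteCategory.comp_apply, ← ConcreteCategory.comp_apply,
      ← Functor.map_comp, ← Functor.map_comp] at this
    exact this
  · intro g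
    obtain ⟨V, hVW, hxV, s, hs⟩ := TopCat.Presheaf.exists_le_germ_eq F.obj g hx
    obtain ⟨V', hxV', hV', hc⟩ := LocallySimplyConnected.exists_le x V hxV
    obtain ⟨t, ht⟩ := (hW V' (hV'.trans hVW) (SimplyConnected.isConnected V')).2
      (F.obj.map (homOfLE hV').op s)
    refine ⟨t, ?_⟩
    rw [← hs, ← TopCat.Presheaf.germ_res_apply F.obj (homOfLE (hV'.trans hVW)) x hxV',
      ← TopCat.Presheaf.germ_res_apply F.obj (homOfLE hV') x hxV']
    exact congrArg _ ht

lemma IsQuasicoherent.isCoveringMap [LocallySimplyConnected X] {F : Shv k X}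
    (hF : IsQuasicoherent F) :
    IsCoveringMap (TopCat.Presheaf.EtaleSpace.base (C := ModuleCat.{u} k) (F := F.obj)) := by
  apply TopCat.Presheaf.EtaleSpace.isCoveringMap_base
  intro x
  obtain ⟨W, hxW, hc, hW⟩ := hF.exists_bijective x
  obtain ⟨W', hxW', hle, hc'⟩ := LocallySimplyConnected.exists_le x W hxW
  have hW'c := SimplyConnected.isConnected W'
  refine ⟨W', hxW', fun y hy => exists_germ_bijective y hy fun V h hV => ?_⟩
  have h1 := hW W' hle hW'c
  have h2 := hW V (h.trans hle) hV
  have : F.obj.map (homOfLE (h.trans hle)).op =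
    F.obj.map (homOfLE hle).op ≫ F.obj.map (homOfLE h).op := by
      rw [← Functor.map_comp]; rfl
  rw [this] at h2
  refine (Function.Bijective.of_comp_iff _ h1).1 ?_
  simpa using h2

/-- The section of the étale space attached to a section of the sheaf is continuous. -/
lemma continuous_germ (F : Shv k X) (W : Opens X) (s : F.obj.obj (op W)) :
    Continuous (fun y : W => (⟨y.1, TopCat.Presheaf.germ (C := ModuleCat.{u} k) F.obj W y.1 y.2 s⟩ :
      TopCat.Presheaf.EtaleSpace (C := ModuleCat.{u} k) F.obj)) := by
  refine continuous_generateFrom_iff.2 ?_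
  rintro _ ⟨V, t, rfl⟩
  rw [isOpen_iff_mem_nhds]
  rintro ⟨y, hy⟩ ⟨hyV, h⟩
  obtain ⟨V', hyV', i, j, e⟩ := TopCat.Presheaf.germ_eq F.obj y hy hyV s t h
  have : Subtype.val ⁻¹' (V' : Set X) ∈ 𝓝 (⟨y, hy⟩ : W) :=
    (V'.isOpen.preimage continuous_subtype_val).mem_nhds hyV'
  filter_upwards [this] with z hz
  exact ⟨j.le hz, TopCat.Presheaf.germ_ext F.obj V' hz i j e⟩

lemma IsQuasicoherent.germ_bijective [LocallySimplyConnected X] {F : Shv k X}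
    (hF : IsQuasicoherent F) (W : Opens X) [SimplyConnected W] (x : X) (hx : x ∈ W) :
    Function.Bijective (TopCat.Presheaf.germ (C := ModuleCat.{u} k) F.obj W x hx) := by
  obtain ⟨S, _, _, h, hh⟩ := SimplyConnected.trivial_of_isCoveringMap (X := W) _ _
    (hF.isCoveringMap.restrictPreimage (W : Set X))
  constructor
  · intro s t hst
    let σ (s : F.obj.obj (op W)) (y : W) : (TopCat.Presheaf.EtaleSpace.base
        (C := ModuleCat.{u} k) (F := F.obj)) ⁻¹' (W : Set X) :=
      ⟨⟨y.1, TopCat.Presheaf.germ (C := ModuleCat.{u} k) F.obj W y.1 y.2 s⟩, y.2⟩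
    have hσ (s) : Continuous (σ s) := (continuous_germ F W s).subtype_mk _
    have hc (s) (y z : W) : (h (σ s y)).2 = (h (σ s z)).2 := by
      have : PreconnectedSpace W := inferInstance
      exact PreconnectedSpace.constant this ((h.continuous.comp (hσ s)).snd)
    refine TopCat.Presheaf.section_ext F W s t fun y hy => ?_
    have h1 : σ s ⟨x, hx⟩ = σ t ⟨x, hx⟩ := by simp only [σ]; rw [hst]
    have h2 : σ s ⟨y, hy⟩ = σ t ⟨y, hy⟩ := by
      apply h.injective
      refine Prod.ext ?_ ?_
      · rw [hh, hh]; rfl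
      · rw [hc s ⟨y, hy⟩ ⟨x, hx⟩, hc t ⟨y, hy⟩ ⟨x, hx⟩, h1]
    simpa [σ] using h2
  · intro g
    let c : S := (h ⟨⟨x, g⟩, hx⟩).2
    let τ (y : W) := h.symm (y, c)
    have hτb (y : W) : (τ y).1.base = y := by
      have := hh (τ y)
      simp only [τ, Homeomorph.apply_symm_apply] at this
      exact (congrArg Subtype.val this).symm
    have hτ : Continuous fun y => (τ y).1 := by fun_prop
    have key (y : W) : ∃ (V : Opens X) (i : V ⟶ W) (f : F.obj.obj (op V)), y.1 ∈ V ∧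
        ∀ z (hz : z ∈ V), (τ ⟨z, i.le hz⟩).1 =
          ⟨z, TopCat.Presheaf.germ (C := ModuleCat.{u} k) F.obj V z hz f⟩ := by
      obtain ⟨U, hU, f, hf⟩ := TopCat.Presheaf.EtaleSpace.exists_section_of_tendsto
        (hτ.tendsto y)
      obtain ⟨N, hN, hNo, hyN⟩ := eventually_nhds_iff.1 hf
      obtain ⟨N', hN'o, rfl⟩ := hNo
      refine ⟨W ⊓ U ⊓ ⟨N', hN'o⟩, homOfLE (inf_le_left.trans inf_le_left),
        F.obj.map (homOfLE (inf_le_left.trans inf_le_right)).op f, ⟨⟨y.2, ?_⟩, hyN⟩, ?_⟩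
      · rw [hτb] at hU; exact hU
      · intro z hz
        obtain ⟨ha, e⟩ := hN ⟨z, hz.1.1⟩ hz.2
        have hb := hτb ⟨z, hz.1.1⟩
        rw [TopCat.Presheaf.germ_res_apply]
        generalize (τ ⟨z, hz.1.1⟩).1 = q at ha e hb
        obtain ⟨b, q⟩ := q
        dsimp at hb ha e
        subst hb
        rw [e]
    choose V i f hyV hf using key
    obtain ⟨s, hs, -⟩ := TopCat.Sheaf.existsUnique_gluing' F V W i
      (fun y hy => Opens.mem_iSup.2 ⟨⟨y, hy⟩, hyV ⟨y, hy⟩⟩) f (by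
        intro a b
        refine TopCat.Presheaf.section_ext F _ _ _ fun y hy => ?_
        erw [TopCat.Presheaf.germ_res_apply, TopCat.Presheaf.germ_res_apply]
        have := (hf a y hy.1).symm.trans (hf b y hy.2)
        simpa using this)
    refine ⟨s, ?_⟩
    have h1 : F.obj.map (i ⟨x, hx⟩).op s = f ⟨x, hx⟩ := hs ⟨x, hx⟩
    rw [← TopCat.Presheaf.germ_res_apply F.obj (i ⟨x, hx⟩) x (hyV ⟨x, hx⟩)]
    rw [h1]
    have h2 := hf ⟨x, hx⟩ x (hyV ⟨x, hx⟩)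
    have h3 : τ ⟨x, hx⟩ = ⟨⟨x, g⟩, hx⟩ := by
      simp only [τ]
      rw [Homeomorph.symm_apply_eq]
      refine Prod.ext ?_ rfl
      rw [hh]; rfl
    rw [h3] at h2
    simpa using h2.symm

lemma IsQuasicoherent.map_bijective [LocallySimplyConnected X] {F : Shv k X}
    (hF : IsQuasicoherent F) {V W : Opens X} [SimplyConnected W] [SimplyConnected V] (i : V ⟶ W) :
    Function.Bijective (F.obj.map i.op) := by
  obtain ⟨x, hx⟩ := (SimplyConnected.isConnected V).nonempty
  have h1 := hF.germ_bijective W x (i.le hx)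
  have h2 := hF.germ_bijective V x hx
  refine (Function.Bijective.of_comp_iff' h2 _).1 ?_
  convert h1 using 1
  ext s
  exact TopCat.Presheaf.germ_res_apply F.obj i x hx s
end

section
variable {k : Type u} [Ring k] {X : TopCat.{u}}

lemma isIso_of_basis {X : Type u} [TopologicalSpace X] {F G : Shv k X} (φ : F ⟶ G) (B : Opens X → Prop)
    (hB : ∀ (x : X) (U : Opens X), x ∈ U → ∃ V : Opens X, x ∈ V ∧ V ≤ U ∧ B V)
    (h : ∀ V, B V → IsIso (φ.hom.app (op V))) : IsIso φ := by
  refine TopCat.Sheaf.isIso_iff_isIso_basis (X := TopCat.of X) (B := fun V : {V // B V} => V.1) ?_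
    (fun V => h V.1 V.2)
  rw [Opens.isBasis_iff_nbhd]
  intro U x hx
  obtain ⟨V, hxV, hV, hb⟩ := hB x U hx
  exact ⟨V, ⟨⟨V, hb⟩, rfl⟩, hxV, hV⟩

lemma hasFreePresentation_congr {X : Type u} [TopologicalSpace X] {F G : Shv k X} (e : F ≅ G)
    (h : HasFreePresentation F) : HasFreePresentation G := by
  obtain ⟨I, J, f, g, w, h1, h2⟩ := h
  refine ⟨I, J, f, g ≫ e.hom, by simp [reassoc_of% w], ?_, inferInstance⟩
  let φ : ShortComplex.mk f g w ≅ ShortComplex.mk f (g ≫ e.hom) (by simp [reassoc_of% w]) :=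
    ShortComplex.isoMk (Iso.refl _) (Iso.refl _) e (by simp) (by simp)
  exact (ShortComplex.exact_iff_of_iso φ).1 h1

lemma isQuasicoherent_of_iso {F G : Shv k X} (e : F ≅ G)
    (h : IsQuasicoherent F) : IsQuasicoherent G := by
  intro x
  obtain ⟨U, hx, h⟩ := h x
  exact ⟨U, hx, hasFreePresentation_congr ((restr k U).mapIso e) h⟩

lemma isQuasicoherent_of_map_bijective [LocallySimplyConnected X] {F : Shv k X}
    (hF : ∀ (V W : Opens X) [SimplyConnected V] [SimplyConnected W] (i : V ⟶ W),
      Function.Bijective (F.obj.map i.op)) : IsQuasicoherent F := by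
  intro x
  obtain ⟨U, hxU, -, hU⟩ := LocallySimplyConnected.exists_le x (⊤ : Opens X) trivial
  refine ⟨U, hxU, ?_⟩
  let G := (restr k U).obj F
  let adj := (constantSheafAdj (Opens.grothendieckTopology U) (ModuleCat.{u} k)
    (T := (⊤ : Opens U)) isTerminalTop)
  suffices IsIso (adj.counit.app G) from
    hasFreePresentation_congr (asIso (adj.counit.app G)) (hasFreePresentation_const _ _)
  have hle (V : Opens U) : U.isOpenEmbedding.functor.obj V ≤ U := by
    rintro _ ⟨y, -, rfl⟩; exact y.2
  refine isIso_of_basis _ (fun V => SimplyConnected (U.isOpenEmbedding.functor.obj V)) ?_ ?_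
  · intro y V hy
    obtain ⟨V', h1, h2, h3⟩ := LocallySimplyConnected.exists_le y.1
      (U.isOpenEmbedding.functor.obj V) ⟨y, hy, rfl⟩
    refine ⟨opensIn U V', h1, ?_, ?_⟩
    · intro z hz
      obtain ⟨z', hz', e⟩ := h2 hz
      obtain rfl : z' = z := Subtype.ext e
      exact hz'
    · rw [functor_opensIn (h2.trans (hle V))]
      exact h3
  · intro V hV
    have hV' : IsConnected (V : Set U) := by
      have := SimplyConnected.isConnected (U.isOpenEmbedding.functor.obj V)
      exact ⟨this.nonempty.of_image,
        U.isOpenEmbedding.isInducing.isPreconnected_image.1 this.isPreconnected⟩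
    have e : constUnit (G.obj.obj (op ⊤)) V ≫ (adj.counit.app G).hom.app (op V) =
        G.obj.map (homOfLE le_top : V ⟶ ⊤).op := by
      have e1 : toSheafify (Opens.grothendieckTopology U) _ ≫ (adj.counit.app G).hom =
          (constantPresheafAdj (ModuleCat.{u} k) isTerminalTop).counit.app G.obj := by
        rw [constantSheafAdj_counit_app]
        simp
      have e2 := NatTrans.congr_app e1 (op V)
      refine e2.trans ?_
      simp [constantPresheafAdj]
      rfl
    have h1 := (ConcreteCategory.isIso_iff_bijective _).2
      (constUnit_bijective (G.obj.obj (op ⊤)) V hV')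
    have e2 : U.isOpenEmbedding.functor.obj ⊤ = U := Opens.isOpenEmbedding_obj_top _
    have : SimplyConnected (U.isOpenEmbedding.functor.obj (⊤ : Opens U)) := by
      have hgen : ∀ V' : Opens X, V' = U → SimplyConnected V' := by rintro _ rfl; exact hU
      exact hgen _ e2
    have h2 : IsIso (G.obj.map (homOfLE le_top : V ⟶ ⊤).op) :=
      (ConcreteCategory.isIso_iff_bijective _).2
        (@hF (U.isOpenEmbedding.functor.obj V) (U.isOpenEmbedding.functor.obj ⊤) hV this _)
    rw [← e] at h2
    exact IsIso.of_isIso_comp_left (constUnit (G.obj.obj (op ⊤)) V) _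

theorem isQuasicoherent_iff [LocallySimplyConnected X] {F : Shv k X} : IsQuasicoherent F ↔
    ∀ (V W : Opens X) [SimplyConnected V] [SimplyConnected W] (i : V ⟶ W),
      Function.Bijective (F.obj.map i.op) :=
  ⟨fun h _ _ _ _ i => h.map_bijective i, isQuasicoherent_of_map_bijective⟩
end

section
variable (k : Type u) [Ring k] (X : TopCat.{u})

/-- The simply connected open subsets of `X`, ordered by inclusion. -/
abbrev SCOpens : Type u := InducedCategory (Opens X) (fun V : {V : Opens X // SimplyConnected V} => V.1)

/-- The inclusion into all open subsets. -/
abbrev SCOpens.incl : SCOpens X ⥤ Opens X := inducedFunctor _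

instance [LocallySimplyConnected X] :
    (SCOpens.incl X).IsCoverDense (Opens.grothendieckTopology X) := by
  refine TopCat.Opens.coverDense_inducedFunctor ?_
  rw [Opens.isBasis_iff_nbhd]
  intro U x hx
  obtain ⟨V, hxV, hV, hb⟩ := LocallySimplyConnected.exists_le x U hx
  exact ⟨V, ⟨⟨V, hb⟩, rfl⟩, hxV, hV⟩

/-- The topology for which sheaves on `SCOpens X` are the same as sheaves on `X`. -/
abbrev SCOpens.topology [LocallySimplyConnected X] : GrothendieckTopology (SCOpens X) :=
  (SCOpens.incl X).inducedTopology (Opens.grothendieckTopology X)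

variable {k X}
lemma SCOpens.isSheaf [LocallySimplyConnected X] (E : (SCOpens X)ᵒᵖ ⥤ ModuleCat.{u} k)
    (hE : ∀ ⦃V W : (SCOpens X)ᵒᵖ⦄ (f : V ⟶ W), IsIso (E.map f)) :
    Presheaf.IsSheaf (SCOpens.topology X) E := by
  rw [Presheaf.isSheaf_iff_isSheaf_forget _ _ (forget (ModuleCat.{u} k)), isSheaf_iff_isSheaf_of_type]
  intro W S hS
  have hS' : S.functorPushforward (SCOpens.incl X) ∈ Opens.grothendieckTopology X W.1 := by
    simpa using hS
  have hb {V W : SCOpens X} (f : V ⟶ W) : Function.Bijective (E.map f.op) :=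
    (ConcreteCategory.isIso_iff_bijective _).1 (hE f.op)
  have hcov : ∀ x ∈ W.1, ∃ (V : SCOpens X) (i : V ⟶ W), S i ∧ x ∈ V.1 := by
    intro x hx
    obtain ⟨V, f, ⟨V', i, j, hi, -⟩, hxV⟩ := hS' x hx
    exact ⟨V', i, hi, j.le hxV⟩
  have hWc := @SimplyConnected.isConnected _ _ W.1 W.2
  intro s hs
  have ex : ∀ x, ∃ m : E.obj (op W), x ∈ W.1 → ∃ (V : SCOpens X) (i : V ⟶ W) (hi : S i), x ∈ V.1 ∧
      E.map i.op m = s i hi := by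
    intro x
    by_cases hx : x ∈ W.1
    · obtain ⟨V, i, hi, hxV⟩ := hcov x hx
      obtain ⟨m, hm⟩ := (hb i).2 (s i hi)
      exact ⟨m, fun _ => ⟨V, i, hi, hxV, hm⟩⟩
    · exact ⟨0, fun h => absurd h hx⟩
  choose m hm using ex
  -- independence of the member of the sieve around a point
  have key : ∀ x (hx : x ∈ W.1) {V V' : SCOpens X} (i : V ⟶ W) (hi : S i) (i' : V' ⟶ W) (hi' : S i')
      (a a' : E.obj (op W)), x ∈ V.1 → x ∈ V'.1 → E.map i.op a = s i hi → E.map i'.op a' = s i' hi' →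
      a = a' := by
    intro x hx V V' i hi i' hi' a a' hxV hxV' ha ha'
    obtain ⟨U, hxU, hU, hsc⟩ := LocallySimplyConnected.exists_le x (V.1 ⊓ V'.1) ⟨hxV, hxV'⟩
    let U' : SCOpens X := ⟨U, hsc⟩
    let j : U' ⟶ V := InducedCategory.homMk (homOfLE (hU.trans inf_le_left))
    let j' : U' ⟶ V' := InducedCategory.homMk (homOfLE (hU.trans inf_le_right))
    have hjj : j ≫ i = j' ≫ i' := rfl
    have := hs j j' hi hi' hjj
    apply (hb (j ≫ i)).1
    have e1 : E.map (j ≫ i).op a = E.map j.op (s i hi) := by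
      rw [op_comp, Functor.map_comp, ConcreteCategory.comp_apply, ha]
    have e2 : E.map (j ≫ i).op a' = E.map j'.op (s i' hi') := by
      rw [hjj, op_comp, Functor.map_comp, ConcreteCategory.comp_apply, ha']
    rw [e1, e2]
    exact this
  obtain ⟨x₀, hx₀⟩ := hWc.nonempty
  have hc : ∀ x ∈ W.1, m x = m x₀ := by
    intro x hx
    refine constant_of_locally hWc.isPreconnected ?_ hx hx₀
    intro x hx
    obtain ⟨V, i, hi, hxV, h⟩ := hm x hx
    refine ⟨V.1, V.1.isOpen, hxV, fun y hy hyV => ?_⟩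
    obtain ⟨V', i', hi', hyV', h'⟩ := hm y hy
    exact key y hy i' hi' i hi _ _ hyV' hyV h' h
  refine ⟨m x₀, ?_, ?_⟩
  · intro V i hi
    obtain ⟨x, hx⟩ := (@SimplyConnected.isConnected _ _ V.1 V.2).nonempty
    have hxW : x ∈ W.1 := i.hom.le hx
    obtain ⟨a, ha⟩ := (hb i).2 (s i hi)
    obtain ⟨V', i', hi', hyV', h'⟩ := hm x hxW
    have : a = m x₀ := (key x hxW i hi i' hi' _ _ hx hyV' ha h').trans (hc x hxW)
    subst this
    exact ha
  · intro t ht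
    obtain ⟨V, i, hi, hxV⟩ := hcov x₀ hx₀
    obtain ⟨V', i', hi', hyV', h'⟩ := hm x₀ hx₀
    exact key x₀ hx₀ i hi i' hi' _ _ hxV hyV' (ht i hi) h'
end

section
variable (k : Type u) [Ring k] (X : TopCat.{u})

/-- The small groupoid obtained from (the opposite of) `SCOpens X` by inverting all inclusions. Its
representations turn out to be the quasi-coherent sheaves; it is only used to show that `Qcoh k X`
is abelian and that its inclusion into all sheaves is exact and has a right adjoint. -/
abbrev SCOpens.Gpd : Type u := (⊤ : MorphismProperty (SCOpens X)ᵒᵖ).Localization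

abbrev SCOpens.Q : (SCOpens X)ᵒᵖ ⥤ SCOpens.Gpd X := (⊤ : MorphismProperty (SCOpens X)ᵒᵖ).Q

noncomputable def SCOpens.whiskerFF :
    ((Functor.whiskeringLeft _ _ (ModuleCat.{u} k)).obj (SCOpens.Q X)).FullyFaithful :=
  Localization.fullyFaithfulWhiskeringLeft (SCOpens.Q X) ⊤ _

variable [LocallySimplyConnected X]

noncomputable def SCOpens.toSheaf : (SCOpens.Gpd X ⥤ ModuleCat.{u} k) ⥤
    Sheaf (SCOpens.topology X) (ModuleCat.{u} k) :=
  ObjectProperty.lift _ ((Functor.whiskeringLeft _ _ (ModuleCat.{u} k)).obj (SCOpens.Q X))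
    fun E => SCOpens.isSheaf _ fun V W f => by
      have : IsIso ((SCOpens.Q X).map f) :=
        Localization.inverts (SCOpens.Q X) (⊤ : MorphismProperty (SCOpens X)ᵒᵖ) f trivial
      exact inferInstanceAs (IsIso (E.map ((SCOpens.Q X).map f)))

noncomputable def SCOpens.toSheafFF : (SCOpens.toSheaf k X).FullyFaithful :=
  Functor.FullyFaithful.ofCompFaithful (G := sheafToPresheaf _ _) (SCOpens.whiskerFF k X)

noncomputable def SCOpens.toSheafAdj : SCOpens.toSheaf k X ⊣
    sheafToPresheaf (SCOpens.topology X) (ModuleCat.{u} k) ⋙ (SCOpens.Q X).ran :=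
  ((SCOpens.Q X).ranAdjunction (ModuleCat.{u} k)).restrictFullyFaithful
    (iC := 𝟭 _) (Functor.FullyFaithful.id _) (fullyFaithfulSheafToPresheaf _ _)
    (Iso.refl _) (Iso.refl _)

instance : (SCOpens.toSheaf k X).IsLeftAdjoint := (SCOpens.toSheafAdj k X).isLeftAdjoint

instance : PreservesFiniteLimits (SCOpens.toSheaf k X) := by
  have : PreservesFiniteLimits (SCOpens.toSheaf k X ⋙ sheafToPresheaf _ _) :=
    inferInstanceAs (PreservesFiniteLimits ((Functor.whiskeringLeft _ _ (ModuleCat.{u} k)).obj (SCOpens.Q X)))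
  exact preservesFiniteLimits_of_reflects_of_preserves _ (sheafToPresheaf _ _)

noncomputable abbrev SCOpens.sheafEquiv :
    Sheaf (SCOpens.topology X) (ModuleCat.{u} k) ≌ Shv k X :=
  Functor.IsDenseSubsite.sheafEquiv (SCOpens.topology X) (Opens.grothendieckTopology X)
    (SCOpens.incl X) (ModuleCat.{u} k)

/-- The sheaf on `X` attached to a representation of the groupoid. -/
noncomputable def localSystem : (SCOpens.Gpd X ⥤ ModuleCat.{u} k) ⥤ Shv k X :=
  SCOpens.toSheaf k X ⋙ (SCOpens.sheafEquiv k X).functor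

instance : (localSystem k X).IsLeftAdjoint := by unfold localSystem; infer_instance
instance : (localSystem k X).Full := by
  have := (SCOpens.toSheafFF k X).full
  unfold localSystem; infer_instance
instance : (localSystem k X).Faithful := by
  have := (SCOpens.toSheafFF k X).faithful
  unfold localSystem; infer_instance
instance : PreservesFiniteLimits (localSystem k X) := by unfold localSystem; infer_instance

variable {X} in
lemma localSystem_essImage_iff (F : Shv k X) : (localSystem k X).essImage F ↔ IsQuasicoherent F := by
  constructor
  · rintro ⟨E, ⟨e⟩⟩
    rw [isQuasicoherent_iff]
    intro V W hV hW i
    let V' : SCOpens X := ⟨V, hV⟩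
    let W' : SCOpens X := ⟨W, hW⟩
    let j : V' ⟶ W' := InducedCategory.homMk i
    let e' : (SCOpens.Q X ⋙ E) ≅ (SCOpens.incl X).op ⋙ F.obj :=
      (sheafToPresheaf _ _).mapIso ((SCOpens.sheafEquiv k X).unitIso.app
        ((SCOpens.toSheaf k X).obj E) ≪≫ (SCOpens.sheafEquiv k X).inverse.mapIso e)
    refine bijective_map_of_iso e' j.op ?_
    have : IsIso ((SCOpens.Q X).map j.op) :=
        Localization.inverts (SCOpens.Q X) (⊤ : MorphismProperty (SCOpens X)ᵒᵖ) j.op trivial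
    exact (ConcreteCategory.isIso_iff_bijective _).1 (inferInstanceAs (IsIso (E.map ((SCOpens.Q X).map j.op))))
  · intro hF
    let P : (SCOpens X)ᵒᵖ ⥤ ModuleCat.{u} k := (SCOpens.incl X).op ⋙ F.obj
    have hP : (⊤ : MorphismProperty (SCOpens X)ᵒᵖ).IsInvertedBy P := by
      rintro ⟨V⟩ ⟨W⟩ f -
      have hV := V.2
      have hW := W.2
      exact (ConcreteCategory.isIso_iff_bijective _).2
        (@IsQuasicoherent.map_bijective _ _ _ _ _ hF _ _ hV hW f.unop.hom)
    let E := Localization.lift P hP (SCOpens.Q X)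
    let e : SCOpens.Q X ⋙ E ≅ P := Localization.fac P hP (SCOpens.Q X)
    let e' : (SCOpens.toSheaf k X).obj E ≅ (SCOpens.sheafEquiv k X).inverse.obj F :=
      (fullyFaithfulSheafToPresheaf _ _).preimageIso e
    exact ⟨E, ⟨(SCOpens.sheafEquiv k X).functor.mapIso e' ≪≫
      (SCOpens.sheafEquiv k X).counitIso.app F⟩⟩
end

section
variable (k : Type u) [Ring k] (X : TopCat.{u})

/-- `Qcoh_k(X)`: the full subcategory of quasi-coherent sheaves. -/
abbrev Qcoh := ObjectProperty.FullSubcategory (fun F : Shv k X => IsQuasicoherent F)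

/-- The inclusion of quasi-coherent sheaves into all sheaves. -/
abbrev qcohIncl : Qcoh k X ⥤ Shv k X := ObjectProperty.ι _

variable [LocallySimplyConnected X]

noncomputable def localSystemEquiv : (SCOpens.Gpd X ⥤ ModuleCat.{u} k) ⥤ Qcoh k X :=
  ObjectProperty.lift _ (localSystem k X) fun E =>
    (localSystem_essImage_iff k _).1 (Functor.obj_mem_essImage _ E)

instance : (localSystemEquiv k X).IsEquivalence where
  faithful := inferInstanceAs (ObjectProperty.lift _ _ _).Faithful
  full := inferInstanceAs (ObjectProperty.lift _ _ _).Full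
  essSurj := ⟨fun F => by
    obtain ⟨E, ⟨e⟩⟩ := (localSystem_essImage_iff k F.obj).2 F.property
    exact ⟨E, ⟨ObjectProperty.isoMk _ e⟩⟩⟩

noncomputable def qcohInclIso : (localSystemEquiv k X).inv ⋙ localSystem k X ≅ qcohIncl k X :=
  Functor.isoWhiskerRight (localSystemEquiv k X).asEquivalence.counitIso (qcohIncl k X) ≪≫
    Functor.leftUnitor _

instance : HasFiniteProducts (Qcoh k X) :=
  ⟨fun _ => Adjunction.hasLimitsOfShape_of_equivalence (localSystemEquiv k X).inv⟩

/-- `Qcoh_k(X)` is abelian (for its additive structure of full subcategory of `Shv k X`). -/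
noncomputable instance : Abelian (Qcoh k X) := abelianOfEquivalence (localSystemEquiv k X).inv

instance : (qcohIncl k X).IsLeftAdjoint := Functor.isLeftAdjoint_of_iso (qcohInclIso k X)
instance : PreservesFiniteLimits (qcohIncl k X) :=
  preservesFiniteLimits_of_natIso (qcohInclIso k X)
instance : PreservesFiniteColimits (qcohIncl k X) := inferInstance
instance : (qcohIncl k X).Additive := inferInstance

/-- The functor `Qc`, right adjoint to the inclusion of quasi-coherent sheaves. -/
noncomputable def Qc : Shv k X ⥤ Qcoh k X := (qcohIncl k X).rightAdjoint

/-- The adjunction between the inclusion and `Qc`. -/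
noncomputable def qcAdj : qcohIncl k X ⊣ Qc k X := Adjunction.ofIsLeftAdjoint _

instance : (Qc k X).Additive := (qcAdj k X).right_adjoint_additive

end

section
variable {C D : Type*} [Category* C] [Category* D] [Abelian C] [Abelian D]
  {L : C ⥤ D} {R : D ⥤ C} (adj : L ⊣ R) [L.Additive] [R.Additive]

/-- An adjunction between additive functors, applied termwise to complexes up to homotopy. -/
noncomputable def adjHomotopy : L.mapHomotopyCategory (.up ℤ) ⊣ R.mapHomotopyCategory (.up ℤ) where
  unit :=
    { app K := (HomotopyCategory.quotient C (.up ℤ)).map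
        ((NatTrans.mapHomologicalComplex adj.unit (.up ℤ)).app K.as)
      naturality := by
        rintro ⟨K⟩ ⟨K'⟩ ⟨f : K ⟶ K'⟩
        exact congrArg (HomotopyCategory.quotient C (.up ℤ)).map
          ((NatTrans.mapHomologicalComplex adj.unit (.up ℤ)).naturality f) }
  counit :=
    { app K := (HomotopyCategory.quotient D (.up ℤ)).map
        ((NatTrans.mapHomologicalComplex adj.counit (.up ℤ)).app K.as)
      naturality := by
        rintro ⟨K⟩ ⟨K'⟩ ⟨f : K ⟶ K'⟩
        exact congrArg (HomotopyCategory.quotient D (.up ℤ)).map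
          ((NatTrans.mapHomologicalComplex adj.counit (.up ℤ)).naturality f) }
  left_triangle_components := by
    rintro ⟨K⟩
    refine congrArg (HomotopyCategory.quotient D (.up ℤ)).map (?_ :
      (L.mapHomologicalComplex (.up ℤ)).map
        ((NatTrans.mapHomologicalComplex adj.unit (.up ℤ)).app K) ≫
        (NatTrans.mapHomologicalComplex adj.counit (.up ℤ)).app
          ((L.mapHomologicalComplex (.up ℤ)).obj K) = 𝟙 _)
    ext i
    exact adj.left_triangle_components (K.X i)
  right_triangle_components := by
    rintro ⟨K⟩
    refine congrArg (HomotopyCategory.quotient C (.up ℤ)).map (?_ :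
      (NatTrans.mapHomologicalComplex adj.unit (.up ℤ)).app
          ((R.mapHomologicalComplex (.up ℤ)).obj K) ≫
      (R.mapHomologicalComplex (.up ℤ)).map
        ((NatTrans.mapHomologicalComplex adj.counit (.up ℤ)).app K) = 𝟙 _)
    ext i
    exact adj.right_triangle_components (K.X i)

/-- The same for bounded below complexes up to homotopy. -/
noncomputable def adjHomotopyPlus : L.mapHomotopyCategoryPlus ⊣ R.mapHomotopyCategoryPlus :=
  (adjHomotopy adj).restrictFullyFaithful (HomotopyCategory.Plus.fullyFaithfulι C)
    (HomotopyCategory.Plus.fullyFaithfulι D) (Iso.refl _) (Iso.refl _)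

variable [HasDerivedCategory C] [HasDerivedCategory D]

lemma inverts_mapPlus (L : C ⥤ D) [L.Additive] [PreservesFiniteLimits L] [PreservesFiniteColimits L] :
    (HomotopyCategory.Plus.quasiIso C).IsInvertedBy
      (L.mapHomotopyCategoryPlus ⋙ DerivedCategory.Plus.Qh) := by
  intro K K' f hf
  have h1 : IsIso (DerivedCategory.Qh.map f.hom) :=
    Localization.inverts DerivedCategory.Qh (HomotopyCategory.quasiIso C (.up ℤ)) f.hom hf
  have h2 : IsIso (L.mapDerivedCategory.map (DerivedCategory.Qh.map f.hom)) := inferInstance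
  have h3 := (NatIso.isIso_map_iff L.mapDerivedCategoryFactorsh f.hom).1 h2
  have : IsIso (DerivedCategory.Plus.ι.map
    ((L.mapHomotopyCategoryPlus ⋙ DerivedCategory.Plus.Qh).map f)) := h3
  exact isIso_of_reflects_iso _ DerivedCategory.Plus.ι

variable [PreservesFiniteLimits L] [PreservesFiniteColimits L]

variable (L) in
/-- The functor `D⁺(C) ⥤ D⁺(D)` induced by an exact functor `L`: apply `L` termwise to complexes. -/
noncomputable def mapDPlus : DerivedCategory.Plus C ⥤ DerivedCategory.Plus D :=
  Localization.lift (L.mapHomotopyCategoryPlus ⋙ DerivedCategory.Plus.Qh) (inverts_mapPlus L)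
    DerivedCategory.Plus.Qh

variable (L) in
/-- `mapDPlus L` is computed by applying `L` termwise. -/
noncomputable def mapDPlusFac : DerivedCategory.Plus.Qh ⋙ mapDPlus L ≅
    L.mapHomotopyCategoryPlus ⋙ DerivedCategory.Plus.Qh :=
  Localization.fac _ (inverts_mapPlus L) _

instance : (mapDPlus L).IsLeftDerivedFunctor (mapDPlusFac L).hom
    (HomotopyCategory.Plus.quasiIso C) :=
  Functor.isLeftDerivedFunctor_of_inverts _ _ _

variable [EnoughInjectives D]

instance : (mapDPlus L ⋙ R.rightDerivedFunctorPlus).IsLeftDerivedFunctor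
    ((Functor.associator _ _ _).inv ≫ Functor.whiskerRight (mapDPlusFac L).hom R.rightDerivedFunctorPlus)
    (HomotopyCategory.Plus.quasiIso C) :=
  Functor.isLeftDerivedFunctor_of_inverts _ _
    ((Functor.associator _ _ _).symm ≪≫ Functor.isoWhiskerRight (mapDPlusFac L) _)

instance {E : Type*} [Category* E] (G : DerivedCategory.Plus C ⥤ E) : (R.rightDerivedFunctorPlus ⋙ G).IsRightDerivedFunctor
    (Functor.whiskerRight R.rightDerivedFunctorPlusUnit G ≫ (Functor.associator _ _ _).hom)
    (HomotopyCategory.Plus.quasiIso D) := by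
  have h : (HomotopyCategory.Plus.localizerMorphism D).Derives
    ((R.mapHomotopyCategoryPlus ⋙ DerivedCategory.Plus.Qh) ⋙ G) :=
    HomotopyCategory.Plus.localizerMorphism_derives _
  refine h.isRightDerivedFunctor_of_isIso _ fun K => ?_
  dsimp
  infer_instance

/-- If `L` is exact with right adjoint `R`, then the functor induced by `L` on `D⁺` is left adjoint
to the right derived functor of `R`; unit and counit are induced by those of the given
adjunction. -/
noncomputable def adjPlus : mapDPlus L ⊣ R.rightDerivedFunctorPlus :=
  (adjHomotopyPlus adj).derived (HomotopyCategory.Plus.quasiIso C) (HomotopyCategory.Plus.quasiIso D)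
    (mapDPlusFac L).hom R.rightDerivedFunctorPlusUnit
end

section
variable {C D : Type*} [Category* C] [Category* D] [Abelian C] [Abelian D]
  (L : C ⥤ D) [L.Additive] [PreservesFiniteLimits L] [PreservesFiniteColimits L]
  [HasDerivedCategory C] [HasDerivedCategory D]

lemma nonempty_homology_mapDPlus (K : DerivedCategory.Plus C) (n : ℤ) :
    Nonempty ((DerivedCategory.Plus.homologyFunctor D n).obj ((mapDPlus L).obj K) ≅
      L.obj ((DerivedCategory.Plus.homologyFunctor C n).obj K)) := by
  obtain ⟨K', ⟨e⟩⟩ := Functor.EssSurj.mem_essImage (F := DerivedCategory.Plus.Qh) K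
  obtain ⟨⟨A⟩, hA⟩ := K'
  refine ⟨(DerivedCategory.Plus.homologyFunctor D n).mapIso
    ((mapDPlus L).mapIso e.symm ≪≫ (mapDPlusFac L).app _) ≪≫ ?_ ≪≫
    L.mapIso ((DerivedCategory.Plus.homologyFunctor C n).mapIso e)⟩
  have e1 : (DerivedCategory.Plus.homologyFunctor C n).obj
      (DerivedCategory.Plus.Qh.obj ⟨⟨A⟩, hA⟩) ≅ A.homology n :=
    (DerivedCategory.homologyFunctorFactorsh C n).app ⟨A⟩ ≪≫
      (HomotopyCategory.homologyFunctorFactors C (.up ℤ) n).app A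
  have e2 : (DerivedCategory.Plus.homologyFunctor D n).obj
      (DerivedCategory.Plus.Qh.obj (L.mapHomotopyCategoryPlus.obj ⟨⟨A⟩, hA⟩)) ≅
        ((L.mapHomologicalComplex (.up ℤ)).obj A).homology n :=
    (DerivedCategory.homologyFunctorFactorsh D n).app _ ≪≫
      (HomotopyCategory.homologyFunctorFactors D (.up ℤ) n).app
        ((L.mapHomologicalComplex (.up ℤ)).obj A)
  exact e2 ≪≫ (A.sc n).mapHomologyIso L ≪≫ L.mapIso e1.symm
end

section
variable (k : Type u) [Ring k] (X : TopCat.{u})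

/-- `D⁺_qc(X)`: the objects of `D⁺(X)` with quasi-coherent cohomology. -/
def DqcPlus [HasDerivedCategory.{w₁} (Shv k X)] : ObjectProperty (DerivedCategory.Plus (Shv k X)) :=
  fun K => ∀ n : ℤ, IsQuasicoherent ((DerivedCategory.Plus.homologyFunctor (Shv k X) n).obj K)

variable [LocallySimplyConnected X]
  [HasDerivedCategory.{w₁} (Shv k X)] [HasDerivedCategory.{w₂} (Qcoh k X)]

/-- The functor `i : D⁺(Qcoh_k(X)) ⥤ D⁺(X)` induced by the exact inclusion. -/
noncomputable def iPlus : DerivedCategory.Plus (Qcoh k X) ⥤ DerivedCategory.Plus (Shv k X) :=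
  mapDPlus (qcohIncl k X)

/-- The functor `i : D⁺(Qcoh_k(X)) ⥤ D⁺_qc(X)`. -/
noncomputable def iqc : DerivedCategory.Plus (Qcoh k X) ⥤ (DqcPlus k X).FullSubcategory :=
  (DqcPlus k X).lift (iPlus k X) fun K n => by
    obtain ⟨e⟩ := nonempty_homology_mapDPlus (qcohIncl k X) K n
    exact isQuasicoherent_of_iso e.symm ((DerivedCategory.Plus.homologyFunctor _ n).obj K).property

/-- The right derived functor `RQc : D⁺(X) ⥤ D⁺(Qcoh_k(X))`. -/
noncomputable def RQc : DerivedCategory.Plus (Shv k X) ⥤ DerivedCategory.Plus (Qcoh k X) :=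
  (Qc k X).rightDerivedFunctorPlus

/-- The adjunction between `i` and `RQc`, with unit `ε : 𝟭 ⟶ i ⋙ RQc` and counit
`μ : RQc ⋙ i ⟶ 𝟭`. -/
noncomputable def derivedAdj : iPlus k X ⊣ RQc k X := adjPlus (qcAdj k X)

/-- `RⁿQc(F)`: the `n`-th cohomology object of `RQc(F)`, for a sheaf `F` placed in degree `0`. -/
noncomputable def RnQc (n : ℤ) : Shv k X ⥤ Qcoh k X :=
  DerivedCategory.Plus.singleFunctor (Shv k X) 0 ⋙ RQc k X ⋙
    DerivedCategory.Plus.homologyFunctor (Qcoh k X) n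

/-- The restriction of `RQc` to `D⁺_qc(X)`. -/
noncomputable def RQcRestrict : (DqcPlus k X).FullSubcategory ⥤ DerivedCategory.Plus (Qcoh k X) :=
  (DqcPlus k X).ι ⋙ RQc k X
end

end KSheaf

/-! Everything is reduced to one statement: if the higher $R^n\operatorname{Qc}$ vanish on
quasi-coherent sheaves, then the counit $\mu$ is an isomorphism on all of $D^+_{\mathrm{qc}}(X)$.
The argument is formal. It uses an exact fully faithful functor $L$ with right adjoint $R$, and the
resulting adjunction on bounded below derived categories.

For an object $B$ in degree $0$, vanishing puts $\mathbb R R(LB)$ in degree $0$, and full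
faithfulness of $L$ then makes the unit at $B$ invertible (`isIso_unit_single`). A triangle identity
and shift compatibility give the counit on $LB$ in any single degree (`isIso_counit_single`). A
general $K$ is treated by dévissage: cut off its lowest cohomology by a truncation triangle and
apply the five lemma (`isIso_homology_counit`). Each cohomological degree needs finitely many cuts,
since $\mathbb R R$ is left t-exact (`isGE_of_adjPlus`); hence no bound from above is required.

Once $\mu$ is invertible on $D^+_{\mathrm{qc}}(X)$, the triangle identity makes $i(\epsilon)$
invertible, and $i$ is conservative (`isIso_of_isIso_mapDPlus_map`), so $\epsilon$ is invertible and
both functors are equivalences. Conversely, an invertible $\epsilon$ identifies $\mathbb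
R\operatorname{Qc}(\mathcal L)$ with $\mathcal L$ in degree $0$, which is the vanishing condition.
-/

namespace KSheaf

open Pretriangulated

/-! ### Long exact sequences of distinguished triangles -/

section
variable {T A : Type*} [Category* T] [Category* A] [Abelian A] [HasZeroObject T] [HasShift T ℤ]
  [Preadditive T] [∀ n : ℤ, (shiftFunctor T n).Additive] [Pretriangulated T]
  (F : T ⥤ A) [F.IsHomological] [F.ShiftSequence ℤ]

/-- The five lemma for the long exact sequences of two distinguished triangles. -/
lemma isIso_shift_map_hom₂ {S S' : Triangle T} (hS : S ∈ distTriang T) (hS' : S' ∈ distTriang T)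
    (φ : S ⟶ S') (n₀ n₁ n₂ : ℤ) (h₁ : n₀ + 1 = n₁) (h₂ : n₁ + 1 = n₂)
    (h₃ : IsIso ((F.shift n₀).map φ.hom₃)) (h₁' : IsIso ((F.shift n₁).map φ.hom₁))
    (h₃' : IsIso ((F.shift n₁).map φ.hom₃)) (h₁'' : IsIso ((F.shift n₂).map φ.hom₁)) :
    IsIso ((F.shift n₁).map φ.hom₂) := by
  -- The stretch $H^{n_0}(S_3)\to H^{n_1}(S_1)\to H^{n_1}(S_2)\to H^{n_1}(S_3)\to H^{n_2}(S_1)$ is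
  -- exact at its three inner terms.
  have ex (S : Triangle T) (hS : S ∈ distTriang T) : (ComposableArrows.mk₄
      (F.homologySequenceδ S n₀ n₁ h₁) ((F.shift n₁).map S.mor₁) ((F.shift n₁).map S.mor₂)
      (F.homologySequenceδ S n₁ n₂ h₂)).Exact :=
    ComposableArrows.exact_of_δ₀ (F.homologySequence_exact₁ S hS n₀ n₁ h₁).exact_toComposableArrows
      (ComposableArrows.exact_of_δ₀ (F.homologySequence_exact₂ S hS n₁).exact_toComposableArrows
        (F.homologySequence_exact₃ S hS n₁ n₂ h₂).exact_toComposableArrows)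
  let ψ := ComposableArrows.homMk₄
    (f := ComposableArrows.mk₄
      (F.homologySequenceδ S n₀ n₁ h₁) ((F.shift n₁).map S.mor₁) ((F.shift n₁).map S.mor₂)
      (F.homologySequenceδ S n₁ n₂ h₂))
    (g := ComposableArrows.mk₄
      (F.homologySequenceδ S' n₀ n₁ h₁) ((F.shift n₁).map S'.mor₁) ((F.shift n₁).map S'.mor₂)
      (F.homologySequenceδ S' n₁ n₂ h₂))
    ((F.shift n₀).map φ.hom₃) ((F.shift n₁).map φ.hom₁) ((F.shift n₁).map φ.hom₂)
    ((F.shift n₁).map φ.hom₃) ((F.shift n₂).map φ.hom₁)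
    (F.homologySequenceδ_naturality S S' φ n₀ n₁ h₁).symm
    (by
      change (F.shift n₁).map S.mor₁ ≫ (F.shift n₁).map φ.hom₂ =
        (F.shift n₁).map φ.hom₁ ≫ (F.shift n₁).map S'.mor₁
      rw [← Functor.map_comp, φ.comm₁, Functor.map_comp])
    (by
      change (F.shift n₁).map S.mor₂ ≫ (F.shift n₁).map φ.hom₃ =
        (F.shift n₁).map φ.hom₂ ≫ (F.shift n₁).map S'.mor₂
      rw [← Functor.map_comp, φ.comm₂, Functor.map_comp])
    (F.homologySequenceδ_naturality S S' φ n₁ n₂ h₂).symm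
  exact Abelian.isIso_of_epi_of_isIso_of_isIso_of_mono (ex S hS) (ex S' hS') ψ
    (show Epi ((F.shift n₀).map φ.hom₃) from inferInstance) h₁' h₃'
    (show Mono ((F.shift n₂).map φ.hom₁) from inferInstance)

lemma isZero_shift_obj₁ {S : Triangle T} (hS : S ∈ distTriang T) (n₀ n₁ : ℤ) (h : n₀ + 1 = n₁)
    (h₃ : IsZero ((F.shift n₀).obj S.obj₃)) (h₂ : IsZero ((F.shift n₁).obj S.obj₂)) :
    IsZero ((F.shift n₁).obj S.obj₁) :=
  (F.homologySequence_exact₁ S hS n₀ n₁ h).isZero_of_both_zeros (h₃.eq_of_src _ _)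
    (h₂.eq_of_tgt _ _)

lemma isIso_shift_map_mor₁ {S : Triangle T} (hS : S ∈ distTriang T) (n₀ n₁ : ℤ) (h : n₀ + 1 = n₁)
    (h₀ : IsZero ((F.shift n₀).obj S.obj₃)) (h₁ : IsZero ((F.shift n₁).obj S.obj₃)) :
    IsIso ((F.shift n₁).map S.mor₁) := by
  have := (F.homologySequence_exact₁ S hS n₀ n₁ h).mono_g (h₀.eq_of_src _ _)
  have := (F.homologySequence_exact₂ S hS n₁).epi_f (h₁.eq_of_tgt _ _)
  dsimp at *
  exact isIso_of_mono_of_epi _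

lemma isIso_shift_map_mor₂ {S : Triangle T} (hS : S ∈ distTriang T) (n₀ n₁ : ℤ) (h : n₀ + 1 = n₁)
    (h₀ : IsZero ((F.shift n₀).obj S.obj₁)) (h₁ : IsZero ((F.shift n₁).obj S.obj₁)) :
    IsIso ((F.shift n₀).map S.mor₂) := by
  have := (F.homologySequence_exact₂ S hS n₀).mono_g (h₀.eq_of_src _ _)
  have := (F.homologySequence_exact₃ S hS n₀ n₁ h).epi_f (h₁.eq_of_tgt _ _)
  dsimp at *
  exact isIso_of_mono_of_epi _
end

/-! ### The functor induced by an exact functor on $D^+$: shifts, triangles, single complexes -/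

section
variable {C D : Type*} [Category* C] [Category* D] [Abelian C] [Abelian D]
  (L : C ⥤ D) [L.Additive] [PreservesFiniteLimits L] [PreservesFiniteColimits L]
  [HasDerivedCategory C] [HasDerivedCategory D]

/-- Presents `mapDPlus L` as a functor descended through the localization, so that its shift
structure can be descended as well. -/
noncomputable instance : Localization.Lifting DerivedCategory.Plus.Qh
    (HomotopyCategory.Plus.quasiIso C) (L.mapHomotopyCategoryPlus ⋙ DerivedCategory.Plus.Qh)
    (mapDPlus L) := ⟨mapDPlusFac L⟩

/-- Quasi-isomorphisms are the maps whose cone is acyclic, and acyclic complexes are stable under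
shift. -/
instance : (HomotopyCategory.Plus.quasiIso C).IsCompatibleWithShift ℤ := by
  rw [HomotopyCategory.Plus.quasiIso_eq_subcategoryAcyclic_trW]
  infer_instance

noncomputable instance : (mapDPlus L).CommShift ℤ :=
  Functor.commShiftOfLocalization DerivedCategory.Plus.Qh (HomotopyCategory.Plus.quasiIso C) ℤ
    (L.mapHomotopyCategoryPlus ⋙ DerivedCategory.Plus.Qh) (mapDPlus L)

instance : NatTrans.CommShift (mapDPlusFac L).hom ℤ :=
  inferInstanceAs (NatTrans.CommShift (Localization.Lifting.iso DerivedCategory.Plus.Qh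
    (HomotopyCategory.Plus.quasiIso C) (L.mapHomotopyCategoryPlus ⋙ DerivedCategory.Plus.Qh)
    (mapDPlus L)).hom ℤ)

instance : (mapDPlus L).IsTriangulated :=
  Functor.isTriangulated_of_precomp_iso (mapDPlusFac L)

/-- On `D⁺`, the functor `mapDPlus L` is the restriction of `L.mapDerivedCategory`. -/
noncomputable def mapDPlusCompι :
    mapDPlus L ⋙ DerivedCategory.Plus.ι ≅ DerivedCategory.Plus.ι ⋙ L.mapDerivedCategory :=
  Localization.liftNatIso DerivedCategory.Plus.Qh (HomotopyCategory.Plus.quasiIso C)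
    (DerivedCategory.Plus.Qh ⋙ mapDPlus L ⋙ DerivedCategory.Plus.ι)
    (DerivedCategory.Plus.Qh ⋙ DerivedCategory.Plus.ι ⋙ L.mapDerivedCategory) _ _
    ((Functor.associator _ _ _).symm ≪≫ Functor.isoWhiskerRight (mapDPlusFac L) _ ≪≫
      (Functor.isoWhiskerLeft (HomotopyCategory.Plus.ι C) L.mapDerivedCategoryFactorsh).symm)

/-- `mapDPlus L` extends `L`. -/
noncomputable def singleCompMapDPlus (n : ℤ) :
    DerivedCategory.Plus.singleFunctor C n ⋙ mapDPlus L ≅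
      L ⋙ DerivedCategory.Plus.singleFunctor D n :=
  ((Functor.FullyFaithful.whiskeringRight DerivedCategory.TStructure.t.plus.fullyFaithfulι _).preimageIso
    (Functor.isoWhiskerLeft (DerivedCategory.Plus.singleFunctor C n) (mapDPlusCompι L) ≪≫
      L.mapDerivedCategorySingleFunctor n))
end

/-! ### Single complexes and cohomological bounds in $D^+$ -/

section
variable {C : Type*} [Category* C] [Abelian C] [HasDerivedCategory C]

noncomputable def fullyFaithfulSingle (n : ℤ) :
    (DerivedCategory.Plus.singleFunctor C n).FullyFaithful :=
  Functor.FullyFaithful.ofCompFaithful (G := DerivedCategory.Plus.ι)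
    (Functor.FullyFaithful.ofFullyFaithful (DerivedCategory.singleFunctor C n))

lemma Plus.isGE_iff (K : DerivedCategory.Plus C) (n : ℤ) :
    K.IsGE n ↔ ∀ i < n, IsZero ((DerivedCategory.Plus.homologyFunctor C i).obj K) := by
  rw [← DerivedCategory.Plus.isGE_ι_obj_iff, DerivedCategory.isGE_iff]
  rfl

lemma Plus.isLE_iff (K : DerivedCategory.Plus C) (n : ℤ) :
    K.IsLE n ↔ ∀ i, n < i → IsZero ((DerivedCategory.Plus.homologyFunctor C i).obj K) := by
  rw [← DerivedCategory.Plus.isLE_ι_obj_iff, DerivedCategory.isLE_iff]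
  rfl

lemma Plus.exists_iso_single (K : DerivedCategory.Plus C) (n : ℤ) [K.IsGE n] [K.IsLE n] :
    ∃ A : C, Nonempty (K ≅ (DerivedCategory.Plus.singleFunctor C n).obj A) := by
  obtain ⟨A, ⟨e⟩⟩ :=
    DerivedCategory.exists_iso_singleFunctor_obj_of_isGE_of_isLE (DerivedCategory.Plus.ι.obj K) n
  exact ⟨A, ⟨DerivedCategory.TStructure.t.plus.fullyFaithfulι.preimageIso e⟩⟩

/-- The homology in degree `n` of an object concentrated in degree `n`. -/
noncomputable def homologySingleIso (A : C) (n : ℤ) : (DerivedCategory.Plus.homologyFunctor C n).obj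
    ((DerivedCategory.Plus.singleFunctor C n).obj A) ≅ A :=
  (DerivedCategory.singleFunctorCompHomologyFunctorIso C n).app A
end

/-! ### The derived adjunction of an exact functor and its right adjoint -/

section
variable {C D : Type*} [Category* C] [Category* D] [Abelian C] [Abelian D]
  {L : C ⥤ D} {R : D ⥤ C} (adj : L ⊣ R) [L.Additive] [R.Additive]
  [PreservesFiniteLimits L] [PreservesFiniteColimits L]
  [HasDerivedCategory C] [HasDerivedCategory D]

lemma isLE_mapDPlus (L : C ⥤ D) [L.Additive] [PreservesFiniteLimits L] [PreservesFiniteColimits L]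
    (K : DerivedCategory.Plus C) (n : ℤ) [hK : K.IsLE n] : ((mapDPlus L).obj K).IsLE n := by
  rw [Plus.isLE_iff] at hK ⊢
  intro i hi
  obtain ⟨e⟩ := nonempty_homology_mapDPlus L K i
  exact (L.map_isZero (hK i hi)).of_iso e

variable [EnoughInjectives D]

-- The right adjoint of a right t-exact functor is left t-exact: the map from the truncation in
-- degrees below $n$ to $\mathbb R R(K)$ is adjoint to a map from an object in degrees $\le n-1$ to
-- $K$, hence zero. It also induces isomorphisms on cohomology below degree $n$.
include adj in
lemma isGE_of_adjPlus (K : DerivedCategory.Plus D) (n : ℤ) [hK : K.IsGE n] :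
    (R.rightDerivedFunctorPlus.obj K).IsGE n := by
  obtain ⟨X, Y, hX, hY, f, g, h, hT⟩ := DerivedCategory.Plus.TStructure.t.exists_triangle
    (R.rightDerivedFunctorPlus.obj K) (n - 1) n (by lia)
  have hX' : X.IsLE (n - 1) := ⟨hX⟩
  have hY' : Y.IsGE n := ⟨hY⟩
  have := isLE_mapDPlus L X (n - 1)
  -- The adjoints of `f` and of `0` are both zero, as there are no nonzero maps from degrees $\le
  -- n-1$ to degrees $\ge n$.
  have hf : f = 0 := by
    apply ((adjPlus adj).homEquiv _ _).symm.injective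
    rw [DerivedCategory.Plus.TStructure.t.zero (((adjPlus adj).homEquiv _ _).symm f) (n - 1) n,
      DerivedCategory.Plus.TStructure.t.zero (((adjPlus adj).homEquiv _ _).symm 0) (n - 1) n]
  rw [Plus.isGE_iff] at hY' ⊢
  intro i hi
  have h1 : IsIso (((DerivedCategory.Plus.homologyFunctor C 0).shift i).map f) :=
    isIso_shift_map_mor₁ (DerivedCategory.Plus.homologyFunctor C 0) hT (i - 1) i (by lia)
      (hY' _ (by lia)) (hY' _ hi)
  have h2 : ((DerivedCategory.Plus.homologyFunctor C 0).shift i).map f = 0 := by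
    rw [hf, Functor.map_zero]
  change IsZero (((DerivedCategory.Plus.homologyFunctor C 0).shift i).obj _)
  exact IsZero.of_epi_eq_zero _ h2

variable [L.Full] [L.Faithful]

/-- The target of the unit is concentrated in degree $0$: below by left t-exactness, above by
vanishing. The unit therefore comes from a morphism `g` of $C$, and Yoneda applies in $C$. This
avoids identifying $H^0$ of the derived functor with $R$. -/
lemma isIso_unit_single (B : C)
    (h : ∀ n : ℤ, 0 < n → IsZero ((DerivedCategory.Plus.homologyFunctor C n).obj
      (R.rightDerivedFunctorPlus.obj ((DerivedCategory.Plus.singleFunctor D 0).obj (L.obj B))))) :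
    IsIso ((adjPlus adj).unit.app ((DerivedCategory.Plus.singleFunctor C 0).obj B)) := by
  let S := DerivedCategory.Plus.singleFunctor C 0
  let Y := R.rightDerivedFunctorPlus.obj ((DerivedCategory.Plus.singleFunctor D 0).obj (L.obj B))
  let e₁ := R.rightDerivedFunctorPlus.mapIso ((singleCompMapDPlus L 0).app B)
  have : Y.IsGE 0 := isGE_of_adjPlus adj _ 0
  have : Y.IsLE 0 := (Plus.isLE_iff _ _).2 h
  obtain ⟨A, ⟨e₂⟩⟩ := Plus.exists_iso_single Y 0
  let e := e₁ ≪≫ e₂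
  obtain ⟨g, hg⟩ := (fullyFaithfulSingle (C := C) 0).map_surjective
    ((adjPlus adj).unit.app (S.obj B) ≫ e.hom)
  -- `mapDPlus L` is not known to be full, but between objects in degree $0$ it is just $L$.
  have ff : (S ⋙ mapDPlus L).FullyFaithful :=
    ((Functor.FullyFaithful.ofFullyFaithful L).comp (fullyFaithfulSingle 0)).ofIso
      (singleCompMapDPlus L 0).symm
  have hL (A' : C) : Function.Bijective
      ((mapDPlus L).map : (S.obj A' ⟶ S.obj B) → _) := by
    rw [← Function.Bijective.of_comp_iff _ ((fullyFaithfulSingle (C := C) 0).map_bijective A' B)]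
    exact ff.map_bijective A' B
  have hg' : IsIso g := by
    -- Composition with `g` becomes, after embedding into the derived category, the action of $L$ on
    -- morphisms followed by the adjunction bijection and the isomorphism `e`.
    refine isIso_of_yoneda_map_bijective g fun A' => ?_
    rw [← Function.Bijective.of_comp_iff' ((fullyFaithfulSingle (C := C) 0).map_bijective A' A)]
    have h1 : Function.Bijective fun f : S.obj A' ⟶ S.obj B =>
        (adjPlus adj).homEquiv _ _ ((mapDPlus L).map f) ≫ e.hom :=
      (e.homToEquiv.bijective.comp ((adjPlus adj).homEquiv _ _).bijective).comp (hL A')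
    have h2 := h1.comp ((fullyFaithfulSingle (C := C) 0).map_bijective A' B)
    convert h2 using 1
    ext f
    dsimp
    rw [Functor.map_comp, hg, Adjunction.homEquiv_unit]
    simp [S]
  have : IsIso ((adjPlus adj).unit.app (S.obj B) ≫ e.hom) := by
    rw [← hg]
    infer_instance
  exact IsIso.of_isIso_comp_right _ e.hom

omit [L.Full] [L.Faithful] in
lemma isIso_counit_shift (K : DerivedCategory.Plus D) (n : ℤ)
    (hK : IsIso ((adjPlus adj).counit.app K)) : IsIso ((adjPlus adj).counit.app (K⟦n⟧)) := by
  -- The derived right adjoint gets the shift structure dictated by the adjunction, for which the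
  -- counit commutes with shifts.
  let := (adjPlus adj).rightAdjointCommShift ℤ
  have := (adjPlus adj).commShift_of_leftAdjoint ℤ
  have h1 := (adjPlus adj).shift_counit_app n K
  have h2 : IsIso (((adjPlus adj).counit.app K)⟦n⟧') := inferInstance
  rw [h1] at h2
  rw [isIso_comp_left_iff, isIso_comp_left_iff] at h2
  exact h2

omit [L.Full] [L.Faithful] in
lemma isIso_counit_of_iso {K K' : DerivedCategory.Plus D} (e : K ≅ K')
    (hK : IsIso ((adjPlus adj).counit.app K)) : IsIso ((adjPlus adj).counit.app K') :=
  (NatTrans.isIso_app_iff_of_iso (adjPlus adj).counit e).1 hK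

lemma isIso_counit_single (B : C)
    (h : ∀ n : ℤ, 0 < n → IsZero ((DerivedCategory.Plus.homologyFunctor C n).obj
      (R.rightDerivedFunctorPlus.obj ((DerivedCategory.Plus.singleFunctor D 0).obj (L.obj B)))))
    (n : ℤ) : IsIso ((adjPlus adj).counit.app
      ((DerivedCategory.Plus.singleFunctor D n).obj (L.obj B))) := by
  have := isIso_unit_single adj B h
  have h1 : IsIso ((adjPlus adj).counit.app
      ((mapDPlus L).obj ((DerivedCategory.Plus.singleFunctor C 0).obj B))) := by
    -- By the triangle identity the counit here is inverse to the image of the unit.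
    have h2 := (adjPlus adj).left_triangle_components
      ((DerivedCategory.Plus.singleFunctor C 0).obj B)
    rw [← IsIso.eq_inv_comp] at h2
    rw [h2]
    infer_instance
  have h2 := isIso_counit_of_iso adj ((singleCompMapDPlus L 0).app B) h1
  have h3 := isIso_counit_shift adj _ (-n) h2
  exact isIso_counit_of_iso adj
    (((DerivedCategory.Plus.singleFunctors D).shiftIso (-n) n 0 (by lia)).app (L.obj B)) h3

/-- Dévissage from below. Removing the cohomology in degree $n$ raises the lower bound to $n+1$ and
leaves $n+m+1=(n+1)+m$ unchanged, so the induction on $m$ must allow every $n$ and $K$. -/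
lemma isIso_homology_counit (h : ∀ (B : C) (n : ℤ), 0 < n →
      IsZero ((DerivedCategory.Plus.homologyFunctor C n).obj (R.rightDerivedFunctorPlus.obj
        ((DerivedCategory.Plus.singleFunctor D 0).obj (L.obj B))))) (m : ℕ) :
    ∀ (n : ℤ) (K : DerivedCategory.Plus D) [K.IsGE n],
      (∀ i, L.essImage ((DerivedCategory.Plus.homologyFunctor D i).obj K)) → ∀ j < n + m,
      IsIso ((DerivedCategory.Plus.homologyFunctor D j).map ((adjPlus adj).counit.app K)) := by
  induction m with
  | zero =>
    intro n K hK _ j hj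
    -- In degrees below $n$, source and target of the counit both have zero cohomology.
    have := isGE_of_adjPlus adj K n
    obtain ⟨e⟩ := nonempty_homology_mapDPlus L (R.rightDerivedFunctorPlus.obj K) j
    have h1 : IsZero ((DerivedCategory.Plus.homologyFunctor D j).obj
        ((R.rightDerivedFunctorPlus ⋙ mapDPlus L).obj K)) :=
      (L.map_isZero (DerivedCategory.Plus.isZero_homology_of_isGE _ n j (by lia))).of_iso e
    exact isIso_of_source_target_iso_zero _ h1.isoZero
      (DerivedCategory.Plus.isZero_homology_of_isGE K n j (by lia)).isoZero
  | succ m ih =>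
    intro n K hK hL j hj
    obtain ⟨X, Y, hX, hY, f, g, d, hT⟩ := DerivedCategory.Plus.TStructure.t.exists_triangle
      K n (n + 1) rfl
    have hX' : X.IsLE n := ⟨hX⟩
    have hY' : Y.IsGE (n + 1) := ⟨hY⟩
    let H := DerivedCategory.Plus.homologyFunctor D 0
    have hX0 (i : ℤ) (hi : n < i) : IsZero ((H.shift i).obj X) := (Plus.isLE_iff _ _).1 hX' i hi
    have hY0 (i : ℤ) (hi : i < n + 1) : IsZero ((H.shift i).obj Y) := (Plus.isGE_iff _ _).1 hY' i hi
    -- The truncation `X` is concentrated in degree $n$, and its cohomology there is that of `K`,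
    -- hence in the essential image of $L$; the single-degree case applies to it.
    have hX'' : X.IsGE n := (Plus.isGE_iff _ _).2 fun i hi =>
      isZero_shift_obj₁ H hT (i - 1) i (by lia) (hY0 _ (by lia))
        (DerivedCategory.Plus.isZero_homology_of_isGE K n i hi)
    have hXn : IsIso ((H.shift n).map f) :=
      isIso_shift_map_mor₁ H hT (n - 1) n (by lia) (hY0 _ (by lia)) (hY0 _ (by lia))
    obtain ⟨A, ⟨e⟩⟩ := Plus.exists_iso_single X n
    obtain ⟨B, ⟨e'⟩⟩ := hL n
    have hX1 : IsIso ((adjPlus adj).counit.app X) :=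
      isIso_counit_of_iso adj ((DerivedCategory.Plus.singleFunctor D n).mapIso
        (e' ≪≫ (asIso ((H.shift n).map f)).symm ≪≫
          (DerivedCategory.Plus.homologyFunctor D n).mapIso e ≪≫ homologySingleIso A n) ≪≫ e.symm)
        (isIso_counit_single adj B (h B) n)
    -- The cohomology of `Y` is zero up to degree $n$ and agrees with that of `K` above.
    have hLY (i : ℤ) : L.essImage ((DerivedCategory.Plus.homologyFunctor D i).obj Y) := by
      by_cases hi : i < n + 1
      · exact ⟨_, ⟨(L.map_isZero (isZero_zero C)).iso (hY0 i hi)⟩⟩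
      · have : IsIso ((DerivedCategory.Plus.homologyFunctor D i).map g) := isIso_shift_map_mor₂ H hT i (i + 1) rfl
          (hX0 _ (by lia)) (hX0 _ (by lia))
        exact L.essImage.prop_of_iso
          (asIso ((DerivedCategory.Plus.homologyFunctor D i).map g)) (hL i)
    have hY1 (i : ℤ) (hi : i < n + 1 + m) := ih (n + 1) Y hLY i hi
    -- A right adjoint of a triangulated functor is triangulated, so the counit gives a morphism of
    -- distinguished triangles over the truncation triangle.
    let := (adjPlus adj).rightAdjointCommShift ℤ
    have := (adjPlus adj).commShift_of_leftAdjoint ℤ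
    have := (adjPlus adj).isTriangulated_rightAdjoint
    let T := Triangle.mk f g d
    let φ : (R.rightDerivedFunctorPlus ⋙ mapDPlus L).mapTriangle.obj T ⟶ T :=
      { hom₁ := (adjPlus adj).counit.app X
        hom₂ := (adjPlus adj).counit.app K
        hom₃ := (adjPlus adj).counit.app Y
        comm₁ := (adjPlus adj).counit.naturality f
        comm₂ := (adjPlus adj).counit.naturality g
        comm₃ := by
          have h1 := NatTrans.shift_app_comm (adjPlus adj).counit (1 : ℤ) X
          have h2 := (adjPlus adj).counit.naturality d
          rw [Functor.commShiftIso_id_hom_app] at h1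
          have h3 := h1.trans (Category.comp_id _)
          exact (Category.assoc _ _ _).trans ((congrArg _ h3).trans h2) }
    -- The five lemma involves `Y` only in degrees $j-1$ and $j$, within the range of the induction
    -- hypothesis; degree $j+1$ occurs only for `X`, where the counit is fully invertible.
    exact isIso_shift_map_hom₂ H
      ((R.rightDerivedFunctorPlus ⋙ mapDPlus L).map_distinguished _ hT) hT φ (j - 1) j (j + 1)
      (by lia) rfl (hY1 _ (by lia)) (inferInstanceAs (IsIso ((H.shift j).map ((adjPlus adj).counit.app X))))
      (hY1 _ (by lia)) (inferInstanceAs (IsIso ((H.shift (j + 1)).map ((adjPlus adj).counit.app X))))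

/-- If the higher derived functors of `R` vanish on the essential image of `L`, then the counit of
the derived adjunction is an isomorphism on objects with homology in this essential image. -/
theorem isIso_counit_of_isZero (h : ∀ (B : C) (n : ℤ), 0 < n →
      IsZero ((DerivedCategory.Plus.homologyFunctor C n).obj (R.rightDerivedFunctorPlus.obj
        ((DerivedCategory.Plus.singleFunctor D 0).obj (L.obj B)))))
    (K : DerivedCategory.Plus D)
    (hK : ∀ i, L.essImage ((DerivedCategory.Plus.homologyFunctor D i).obj K)) :
    IsIso ((adjPlus adj).counit.app K) := by
  obtain ⟨n, hn⟩ := K.property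
  have : K.IsGE n := (DerivedCategory.Plus.isGE_ι_obj_iff K n).1 hn
  rw [DerivedCategory.Plus.isIso_iff]
  intro j
  -- Isomorphisms are detected degree by degree, and this number of cuts reaches past degree `j`.
  exact isIso_homology_counit adj h (j - n + 1).toNat n K hK j (by lia)

-- Apply the functor to the cone: its cohomology is killed by $L$, and a faithful additive functor
-- kills only zero objects.
omit [EnoughInjectives D] [L.Full] in
lemma isIso_of_isIso_mapDPlus_map (L : C ⥤ D) [L.Additive] [PreservesFiniteLimits L]
    [PreservesFiniteColimits L] [L.Faithful] {K K' : DerivedCategory.Plus C} (f : K ⟶ K')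
    (hf : IsIso ((mapDPlus L).map f)) : IsIso f := by
  obtain ⟨Z, g, d, hT⟩ := distinguished_cocone_triangle f
  have hZ : IsZero ((mapDPlus L).obj Z) := (Triangle.isZero₃_iff_isIso₁ _
    ((mapDPlus L).map_distinguished _ hT)).2 hf
  refine (Triangle.isZero₃_iff_isIso₁ _ hT).1 ?_
  have h0 (i : ℤ) : IsZero ((DerivedCategory.Plus.homologyFunctor C i).obj Z) := by
    obtain ⟨e⟩ := nonempty_homology_mapDPlus L Z i
    rw [IsZero.iff_id_eq_zero]
    apply L.map_injective
    exact ((((DerivedCategory.Plus.homologyFunctor D i).map_isZero hZ).of_iso e.symm)).eq_of_src _ _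
  -- With no cohomology at all, `Z` lies in degrees $\le 0$ and in degrees $\ge 1$, hence is zero.
  have := (Plus.isLE_iff Z 0).2 fun i _ => h0 i
  have := (Plus.isGE_iff Z 1).2 fun i _ => h0 i
  exact DerivedCategory.Plus.TStructure.t.isZero Z 0 1
end

/-! ### Restricting an adjunction to a full subcategory -/

section
variable {A B : Type*} [Category* A] [Category* B] {F : A ⥤ B} {G : B ⥤ A} (adj : F ⊣ G)
  (P : ObjectProperty B) (hP : ∀ a, P (F.obj a))

/-- The restriction of an adjunction to a full subcategory containing the image of the left
adjoint. -/
noncomputable def adjLift : P.lift F hP ⊣ P.ι ⋙ G :=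
  adj.restrictFullyFaithful (iC := 𝟭 _) (iD := P.ι)
    (Functor.FullyFaithful.id _) P.fullyFaithfulι (Iso.refl _) (Iso.refl _)

lemma adjLift_unit_app (a : A) : (adjLift adj P hP).unit.app a = adj.unit.app a := by
  have := adj.map_restrictFullyFaithful_unit_app (iC := 𝟭 _) (iD := P.ι)
    (L := P.lift F hP) (R := P.ι ⋙ G)
    (Functor.FullyFaithful.id _) P.fullyFaithfulι (Iso.refl _) (Iso.refl _) a
  simp at this
  exact this

lemma ι_map_adjLift_counit_app (b : P.FullSubcategory) :
    P.ι.map ((adjLift adj P hP).counit.app b) = adj.counit.app b.obj := by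
  have := adj.map_restrictFullyFaithful_counit_app (iC := 𝟭 _) (iD := P.ι)
    (L := P.lift F hP) (R := P.ι ⋙ G)
    (Functor.FullyFaithful.id _) P.fullyFaithfulι (Iso.refl _) (Iso.refl _) b
  simp at this
  exact this

lemma isIso_adjLift_unit_iff : IsIso (adjLift adj P hP).unit ↔ IsIso adj.unit := by
  rw [NatTrans.isIso_iff_isIso_app, NatTrans.isIso_iff_isIso_app]
  exact forall_congr' fun a => iff_of_eq (congrArg (fun f => IsIso f) (adjLift_unit_app adj P hP a))

/-- The inclusion reflects isomorphisms and sends the restricted counit to the original one. -/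
lemma isIso_adjLift_counit_iff : IsIso (adjLift adj P hP).counit ↔
    ∀ b, P b → IsIso (adj.counit.app b) := by
  rw [NatTrans.isIso_iff_isIso_app]
  have key (b : P.FullSubcategory) :
      IsIso ((adjLift adj P hP).counit.app b) ↔ IsIso (adj.counit.app b.obj) := by
    rw [← ι_map_adjLift_counit_app adj P hP]
    exact (isIso_iff_of_reflects_iso _ P.ι).symm
  exact ⟨fun h b hb => (key ⟨b, hb⟩).1 (h _), fun h b => (key b).2 (h _ b.property)⟩

include adj in
lemma isIso_map_unit_app (a : A) (h : IsIso (adj.counit.app (F.obj a))) :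
    IsIso (F.map (adj.unit.app a)) := by
  have h2 := adj.left_triangle_components a
  have := IsIso.inv_eq_of_inv_hom_id h2
  rw [← this]
  infer_instance
end

/-! ### The adjunction between $D^+(\operatorname{Qcoh}_k(X))$ and $D^+_{\mathrm{qc}}(X)$ -/

section
variable (k : Type u) [Ring k] (X : TopCat.{u}) [LocallySimplyConnected X]
  [HasDerivedCategory.{w₁} (Shv k X)] [HasDerivedCategory.{w₂} (Qcoh k X)]

/-- The adjunction between `i : D⁺(Qcoh_k(X)) ⥤ D⁺_qc(X)` and the restriction of `RQc`. -/
noncomputable def iqcAdj : iqc k X ⊣ RQcRestrict k X :=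
  adjLift (derivedAdj k X) (DqcPlus k X) fun K => ((iqc k X).obj K).property

lemma isIso_iqcAdj_unit_iff : IsIso (iqcAdj k X).unit ↔ IsIso (derivedAdj k X).unit :=
  isIso_adjLift_unit_iff _ _ _

lemma isIso_iqcAdj_counit_iff : IsIso (iqcAdj k X).counit ↔
    ∀ K, DqcPlus k X K → IsIso ((derivedAdj k X).counit.app K) :=
  isIso_adjLift_counit_iff _ _ _

/-- The counit is invertible on the image of $i$, so $i(\epsilon)$ is its inverse by the triangle
identity; conservativity of $i$ concludes. -/
lemma isIso_derivedAdj_unit_of_counit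
    (h : ∀ K, DqcPlus k X K → IsIso ((derivedAdj k X).counit.app K)) :
    IsIso (derivedAdj k X).unit := by
  rw [NatTrans.isIso_iff_isIso_app]
  intro K
  apply isIso_of_isIso_mapDPlus_map (qcohIncl k X)
  exact isIso_map_unit_app (derivedAdj k X) K (h _ ((iqc k X).obj K).property)

/-- The unit identifies $\mathbb R\operatorname{Qc}(F)$ with $F$ itself, viewed in
$\operatorname{Qcoh}_k(X)$ and placed in degree $0$. -/
lemma isZero_RnQc_of_isIso_unit (h : IsIso (derivedAdj k X).unit) (n : ℤ) (hn : 0 < n)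
    (F : Shv k X) (hF : IsQuasicoherent F) : IsZero ((RnQc k X n).obj F) := by
  let F' : Qcoh k X := ⟨F, hF⟩
  let e : (DerivedCategory.Plus.singleFunctor (Qcoh k X) 0).obj F' ≅
      (RQc k X).obj ((DerivedCategory.Plus.singleFunctor (Shv k X) 0).obj F) :=
    (asIso (derivedAdj k X).unit).app _ ≪≫
      (RQc k X).mapIso ((singleCompMapDPlus (qcohIncl k X) 0).app F')
  exact (DerivedCategory.Plus.isZero_homology_of_isLE
    ((DerivedCategory.Plus.singleFunctor (Qcoh k X) 0).obj F') 0 n hn).of_iso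
      ((DerivedCategory.Plus.homologyFunctor _ n).mapIso e.symm)

lemma isIso_derivedAdj_counit_of_isZero_RnQc
    (h : ∀ n : ℤ, 0 < n → ∀ F : Shv k X, IsQuasicoherent F → IsZero ((RnQc k X n).obj F))
    (K : DerivedCategory.Plus (Shv k X)) (hK : DqcPlus k X K) :
    IsIso ((derivedAdj k X).counit.app K) :=
  isIso_counit_of_isZero (qcAdj k X) (fun B n hn => h n hn B.obj B.property) K
    fun i => ⟨⟨_, hK i⟩, ⟨Iso.refl _⟩⟩

end
end KSheaf

/-! ### Equivalence of the conditions -/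

theorem mainTheorem2 (k : Type u) [Ring k] (X : TopCat.{u}) [ConnectedSpace X]
    [KSheaf.LocallySimplyConnected X]
    [HasDerivedCategory.{w₁} (KSheaf.Shv k X)] [HasDerivedCategory.{w₂} (KSheaf.Qcoh k X)] :
    List.TFAE [
      (KSheaf.iqc k X).IsEquivalence,
      (KSheaf.iqc k X).Full ∧ (KSheaf.iqc k X).Faithful,
      IsIso (KSheaf.derivedAdj k X).unit,
      ∀ n : ℤ, 0 < n → ∀ F : KSheaf.Shv k X, KSheaf.IsQuasicoherent F →
        IsZero ((KSheaf.RnQc k X n).obj F),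
      (KSheaf.RQcRestrict k X).Full ∧ (KSheaf.RQcRestrict k X).Faithful,
      ∀ K : DerivedCategory.Plus (KSheaf.Shv k X), KSheaf.DqcPlus k X K →
        IsIso ((KSheaf.derivedAdj k X).counit.app K),
      (KSheaf.RQcRestrict k X).IsEquivalence] := by
  -- Invertibility of $\mu$ on $D^+_{\mathrm{qc}}(X)$ is the hub: it makes both unit and counit of
  -- the restricted adjunction invertible.
  have equiv (h : ∀ K : DerivedCategory.Plus (KSheaf.Shv k X), KSheaf.DqcPlus k X K →
      IsIso ((KSheaf.derivedAdj k X).counit.app K)) :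
      (KSheaf.iqc k X).IsEquivalence ∧ (KSheaf.RQcRestrict k X).IsEquivalence := by
    have := (KSheaf.isIso_iqcAdj_counit_iff k X).2 h
    have := (KSheaf.isIso_iqcAdj_unit_iff k X).2 (KSheaf.isIso_derivedAdj_unit_of_counit k X h)
    exact ⟨(KSheaf.iqcAdj k X).toEquivalence.isEquivalence_functor,
      (KSheaf.iqcAdj k X).toEquivalence.isEquivalence_inverse⟩
  tfae_have 1 → 2 := fun h => ⟨h.full, h.faithful⟩
  -- A left adjoint is fully faithful exactly when the unit is invertible; dually, `5 → 6` uses the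
  -- counit for the right adjoint.
  tfae_have 2 → 3 := fun ⟨_, _⟩ => (KSheaf.isIso_iqcAdj_unit_iff k X).1 inferInstance
  tfae_have 3 → 4 := KSheaf.isZero_RnQc_of_isIso_unit k X
  tfae_have 4 → 6 := KSheaf.isIso_derivedAdj_counit_of_isZero_RnQc k X
  tfae_have 6 → 1 := fun h => (equiv h).1
  tfae_have 6 → 7 := fun h => (equiv h).2
  tfae_have 7 → 5 := fun h => ⟨h.full, h.faithful⟩
  tfae_have 5 → 6 := fun ⟨_, _⟩ => (KSheaf.isIso_iqcAdj_counit_iff k X).1 inferInstance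
  tfae_finish
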